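/- **Setting.** Consider $x_{k+1}=Ax_k+Bu_k+w_k$, $y_k=Cx_k+v_k$ ($k\ge 0$) with $x_k\in\mathbb R^{n_x}$, $u_k\in\mathbb R^{n_u}$, $y_k\in\mathbb R^{n_y}$, where $(w_k)$ and $(v_k)$ are i.i.d. sequences of centred Gaussian vectors with covariances $\Omega_w\succ0$, $\Omega_v\succ0$, and $x_0\sim\mathcal N(\bar x_0,\Omega_{x_0})$, $\Omega_{x_0}\succeq0$, is uncorrelated with all $w_k$ and $v_k$. Let $Q\succeq 0$, $R\succ0$, $\theta>0$, let $(A,B)$ be controllable, and let $p,h\ge1$ be integers with $p\mid h$. The information at time $k$ is $\mathcal I_k=\{y_i,u_j,\delta_j: 0\le i\le k,\ 0\le j\le k-1\}$ and $\hat x_k=\mathbb E[x_k\mid\sigma(\mathcal I_k)]$. Put $\Sigma_0^-=\Omega_{x_0}$, $\Sigma_k=\Sigma_k^--\Sigma_k^-C^\top(C\Sigma_k^-C^\top+\Omega_v)^{-1}C\Sigma_k^-$, $\Sigma_{k+1}^-=A\Sigma_kA^\top+\Omega_w$. **Base policy.** Let $B_p=A^{p-1}B$, $Q_p=\sum_{i=0}^{p-1}(A^i)^\top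 QA^i$, $S_p=\sum_{i=1}^{p-1}(A^i)^\top QA^{i-1}B$, $R_p=R+\sum_{i=1}^{p-1}B^\top(A^{i-1})^\top QA^{i-1}B$, and let $\tilde P_p$ be a positive definite solution of $$\tilde P_p=Q_p+(A^p)^\top\tilde P_pA^p-\tilde F_p^\top(B_p^\top\tilde P_pB_p+R_p)\tilde F_p,\qquad \tilde F_p=-(B_p^\top\tilde P_pB_p+R_p)^{-1}(B_p^\top\tilde P_pA^p+S_p^\top).$$ **Rollout policy.** For each of the $2^h$ patterns $\rho=(\rho_0,\dots,\rho_{h-1})\in\{0,1\}^h$ let $P^\rho_h=\tilde P_p$ and, for $s=h-1,\dots,0$, $$P^\rho_s=Q+A^\top P^\rho_{s+1}A-\rho_sA^\top P^\rho_{s+1}B(B^\top P^\rho_{s+1}B+R)^{-1}B^\top P^\rho_{s+1}A,$$ $$F^\rho_s=-(B^\top P^\rho_{s+1}B+R)^{-1}B^\top P^\rho_{s+1}A,\qquad M^\rho_s=\rho_s(F^\rho_s)^\top(B^\top P^\rho_{s+1}B+R)F^\rho_s,$$ $$\beta^\rho_k=\sum_{\tau=0}^{h-1}\bigl(\operatorname{tr}(P^\rho_{\tau+1}\Omega_w)+\operatorname{tr}(M^\rho_\tau\Sigma_{k+\tau})\bigr),\qquad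 \gamma^\rho=\theta\sum_{\tau=0}^{h-1}\rho_\tau.$$ At each time $k=\ell h$, $\ell\ge0$, the rollout policy chooses a pattern $\rho=\varphi(\mathcal I_{\ell h})$ (depending measurably on $\mathcal I_{\ell h}$) that minimizes $\hat x_{\ell h}^\top P^\rho_0\hat x_{\ell h}+\operatorname{tr}(P^\rho_0\Sigma_{\ell h})+\beta^\rho_{\ell h}+\gamma^\rho$, and then applies $\delta_k=\rho_{k-\ell h}$, $u_k=\rho_{k-\ell h}F^\rho_{k-\ell h}\hat x_k$ for $\ell h\le k<(\ell+1)h$. **Theorem.** Suppose that 1. any two distinct eigenvalues $\lambda_1\ne\lambda_2$ of $A$ satisfy $\lambda_1\neq\lambda_2\exp(2\pi q\sqrt{-1}/p)$ for all $q\in\mathbb Z$; 2. (i) $\operatorname{rank}C=n_x$; (ii) $Q\succ0$; (iii) $\Omega_{x_0}=\Omega_w+A\Omega_{x_0}A^\top-A\Omega_{x_0}C^\top(C\Omega_{x_0}C^\top+\Omega_v)^{-1}C\Omega_{x_0}A^\top$. Then a positive definite $\tilde P_p$ as above exists, and for every such $\tilde P_p$ the closed loop under the rollout policy is mean-square stable: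 $\sup_{k\ge0}\mathbb E[\|x_k\|^2]<\infty$. -/

import Mathlib

open MeasureTheory ProbabilityTheory Matrix

noncomputable section

/-- Real `m`-dimensional space with the Euclidean norm. -/
abbrev Vec (m : ℕ) : Type := EuclideanSpace ℝ (Fin m)

/-- The quadratic form `xᵀ M x`. -/
def quadForm {m : ℕ} (M : Matrix (Fin m) (Fin m) ℝ) (x : Vec m) : ℝ :=
  x.ofLp ⬝ᵥ (M *ᵥ x.ofLp)

/-- The matrix data of the problem: the plant `x⁺ = A x + B u + w`, `y = C x + v`, the stage cost
`xᵀ Q x + uᵀ R u`, the noise covariances, and the mean and covariance of the initial state. -/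
structure PlantData (nx nu ny : ℕ) where
  A : Matrix (Fin nx) (Fin nx) ℝ
  B : Matrix (Fin nx) (Fin nu) ℝ
  C : Matrix (Fin ny) (Fin nx) ℝ
  Q : Matrix (Fin nx) (Fin nx) ℝ
  R : Matrix (Fin nu) (Fin nu) ℝ
  Ωw : Matrix (Fin nx) (Fin nx) ℝ
  Ωv : Matrix (Fin ny) (Fin ny) ℝ
  Ω₀ : Matrix (Fin nx) (Fin nx) ℝ
  xbar : Vec nx

/-- `(A, B)` is controllable: `[B, A B, …, A^(n-1) B]` has full row rank. -/
def IsControllablePair {n m : ℕ} (A : Matrix (Fin n) (Fin n) ℝ) (B : Matrix (Fin n) (Fin m) ℝ) :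
    Prop :=
  (Matrix.of fun (i : Fin n) (kj : Fin n × Fin m) => (A ^ (kj.1 : ℕ) * B) i kj.2).rank = n

/-- No two distinct (complex) eigenvalues of `A` differ by a factor which is a `p`-th root of
unity. -/
def EigenvalueCondition {n : ℕ} (A : Matrix (Fin n) (Fin n) ℝ) (p : ℕ) : Prop :=
  ∀ l₁ l₂ : ℂ,
    Module.End.HasEigenvalue (Matrix.toLin' (A.map (algebraMap ℝ ℂ))) l₁ →
    Module.End.HasEigenvalue (Matrix.toLin' (A.map (algebraMap ℝ ℂ))) l₂ →
    l₁ ≠ l₂ →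
    ∀ q : ℤ, l₁ ≠ l₂ * Complex.exp (2 * Real.pi * q * Complex.I / p)

namespace PlantData

variable {nx nu ny : ℕ} (S : PlantData nx nu ny)

/-! ### Kalman filter covariances -/

/-- The measurement update `Σ = Σ⁻ - Σ⁻ Cᵀ (C Σ⁻ Cᵀ + Ωv)⁻¹ C Σ⁻`. -/
def measUpdate (Z : Matrix (Fin nx) (Fin nx) ℝ) : Matrix (Fin nx) (Fin nx) ℝ :=
  Z - Z * S.Cᵀ * (S.C * Z * S.Cᵀ + S.Ωv)⁻¹ * S.C * Z

/-- The a priori error covariance `Σ⁻_k`. -/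
def priorCov : ℕ → Matrix (Fin nx) (Fin nx) ℝ
  | 0 => S.Ω₀
  | k + 1 => S.A * S.measUpdate (priorCov k) * S.Aᵀ + S.Ωw

/-- The a posteriori error covariance `Σ_k`. -/
def errCov (k : ℕ) : Matrix (Fin nx) (Fin nx) ℝ := S.measUpdate (S.priorCov k)

/-! ### Periodic base policy with period `p`, for the average cost -/

/-- `B_p = A^(p-1) B`. -/
def Bp (p : ℕ) : Matrix (Fin nx) (Fin nu) ℝ := S.A ^ (p - 1) * S.B

/-- `Q_p = ∑_{i=0}^{p-1} (Aⁱ)ᵀ Q Aⁱ`. -/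
def Qp (p : ℕ) : Matrix (Fin nx) (Fin nx) ℝ :=
  ∑ i ∈ Finset.range p, (S.A ^ i)ᵀ * S.Q * S.A ^ i

/-- `S_p = ∑_{i=1}^{p-1} (Aⁱ)ᵀ Q A^(i-1) B`. -/
def Sp (p : ℕ) : Matrix (Fin nx) (Fin nu) ℝ :=
  ∑ i ∈ Finset.Ico 1 p, (S.A ^ i)ᵀ * S.Q * S.A ^ (i - 1) * S.B

/-- `R_p = R + ∑_{i=1}^{p-1} Bᵀ (A^(i-1))ᵀ Q A^(i-1) B`. -/
def Rp (p : ℕ) : Matrix (Fin nu) (Fin nu) ℝ :=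
  S.R + ∑ i ∈ Finset.Ico 1 p, S.Bᵀ * (S.A ^ (i - 1))ᵀ * S.Q * S.A ^ (i - 1) * S.B

/-- The periodic feedback gain `F̃_p` belonging to a cost matrix `P`. -/
def periodicGain (p : ℕ) (P : Matrix (Fin nx) (Fin nx) ℝ) : Matrix (Fin nu) (Fin nx) ℝ :=
  -((S.Bp p)ᵀ * P * S.Bp p + S.Rp p)⁻¹ * ((S.Bp p)ᵀ * P * S.A ^ p + (S.Sp p)ᵀ)

/-- `P` is a positive definite solution of the algebraic Riccati equation of the optimal
`p`-periodic average-cost control problem. -/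
def IsPeriodicRiccatiSolution (p : ℕ) (P : Matrix (Fin nx) (Fin nx) ℝ) : Prop :=
  P.PosDef ∧
    P = S.Qp p + (S.A ^ p)ᵀ * P * S.A ^ p
      - (S.periodicGain p P)ᵀ * ((S.Bp p)ᵀ * P * S.Bp p + S.Rp p) * S.periodicGain p P

/-! ### Rollout over a window of length `h`

A triggering pattern is `m : Fin h → Bool`; `m s = true` means that the actuators are used at the
`s`-th step of the window. There are `2 ^ h` patterns. `Pt` is the terminal cost matrix. -/

/-- The value of the pattern at step `s` (`false` outside the window). -/
def trig {h : ℕ} (m : Fin h → Bool) (s : ℕ) : Bool :=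
  if hs : s < h then m ⟨s, hs⟩ else false

/-- One backward step of the Riccati recursion, with (`b = true`) or without (`b = false`) the
possibility to act. -/
def riccatiStep (b : Bool) (P : Matrix (Fin nx) (Fin nx) ℝ) : Matrix (Fin nx) (Fin nx) ℝ :=
  S.Q + S.Aᵀ * P * S.A
    - if b then S.Aᵀ * P * S.B * (S.Bᵀ * P * S.B + S.R)⁻¹ * S.Bᵀ * P * S.A else 0

/-- The cost matrices of the pattern `m`: `P_h = Pt`, and `P_s` is obtained from `P_{s+1}` by a
Riccati step. -/
def rolloutP (Pt : Matrix (Fin nx) (Fin nx) ℝ) {h : ℕ} (m : Fin h → Bool) (s : ℕ) :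
    Matrix (Fin nx) (Fin nx) ℝ :=
  if s < h then S.riccatiStep (trig m s) (rolloutP Pt m (s + 1)) else Pt
termination_by h - s

/-- The gain `F_s = -(Bᵀ P_{s+1} B + R)⁻¹ Bᵀ P_{s+1} A` of the pattern `m`. -/
def rolloutF (Pt : Matrix (Fin nx) (Fin nx) ℝ) {h : ℕ} (m : Fin h → Bool) (s : ℕ) :
    Matrix (Fin nu) (Fin nx) ℝ :=
  -(S.Bᵀ * S.rolloutP Pt m (s + 1) * S.B + S.R)⁻¹ * S.Bᵀ * S.rolloutP Pt m (s + 1) * S.A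

/-- `M_s = F_sᵀ (Bᵀ P_{s+1} B + R) F_s` at the actuation steps of the pattern `m`, and `0` at its
other steps. -/
def rolloutM (Pt : Matrix (Fin nx) (Fin nx) ℝ) {h : ℕ} (m : Fin h → Bool) (s : ℕ) :
    Matrix (Fin nx) (Fin nx) ℝ :=
  if trig m s then
    (S.rolloutF Pt m s)ᵀ * (S.Bᵀ * S.rolloutP Pt m (s + 1) * S.B + S.R) * S.rolloutF Pt m s
  else 0

/-- `β_k = ∑_{τ<h} (tr (P_{τ+1} Ωw) + tr (M_τ Σ_{k+τ}))`. -/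
def rolloutBeta (Pt : Matrix (Fin nx) (Fin nx) ℝ) {h : ℕ} (m : Fin h → Bool) (k : ℕ) : ℝ :=
  ∑ τ ∈ Finset.range h,
    ((S.rolloutP Pt m (τ + 1) * S.Ωw).trace + (S.rolloutM Pt m τ * S.errCov (k + τ)).trace)

/-- `γ = θ ∑_{τ<h} ρ_τ`, the actuation penalty of the pattern `m`. -/
def rolloutGamma (θ : ℝ) {h : ℕ} (m : Fin h → Bool) : ℝ :=
  θ * ∑ τ ∈ Finset.range h, if trig m τ then (1 : ℝ) else 0

/-- The `h`-step lookahead cost of the pattern `m` at time `k` and state estimate `z`. -/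
def rolloutCost (Pt : Matrix (Fin nx) (Fin nx) ℝ) (θ : ℝ) {h : ℕ} (m : Fin h → Bool) (k : ℕ)
    (z : Vec nx) : ℝ :=
  quadForm (S.rolloutP Pt m 0) z + (S.rolloutP Pt m 0 * S.errCov k).trace
    + S.rolloutBeta Pt m k + rolloutGamma θ m

end PlantData

/-- The σ-algebra of the information `{y_i, u_j, δ_j : i ≤ k, j < k}` available at time `k`. -/
abbrev infoSigma {Ω : Type*} {nu ny : ℕ} (y : ℕ → Ω → Vec ny) (u : ℕ → Ω → Vec nu)
    (δ : ℕ → Ω → Bool) (k : ℕ) : MeasurableSpace Ω :=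
  (⨆ i : Fin (k + 1), MeasurableSpace.comap (y i) inferInstance) ⊔
    ⨆ j : Fin k, (MeasurableSpace.comap (u j) inferInstance ⊔
      MeasurableSpace.comap (δ j) inferInstance)

/-- The random data of the plant: Gaussian initial state, and two i.i.d. centred Gaussian noise
sequences, with the prescribed means and covariances; the initial state is uncorrelated with the
noises. -/
structure IsPlantNoise {Ω : Type*} [MeasurableSpace Ω] (μ : Measure Ω) {nx nu ny : ℕ}
    (S : PlantData nx nu ny) (x₀ : Ω → Vec nx) (w : ℕ → Ω → Vec nx) (v : ℕ → Ω → Vec ny) :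
    Prop where
  measurable_init : Measurable x₀
  measurable_w : ∀ k, Measurable (w k)
  measurable_v : ∀ k, Measurable (v k)
  law_init : HasLaw x₀ (multivariateGaussian S.xbar S.Ω₀) μ
  law_w : ∀ k, HasLaw (w k) (multivariateGaussian 0 S.Ωw) μ
  law_v : ∀ k, HasLaw (v k) (multivariateGaussian 0 S.Ωv) μ
  indep_w : iIndepFun w μ
  indep_v : iIndepFun v μ
  uncorr_w : ∀ k i j, cov[fun ω => x₀ ω i, fun ω => w k ω j; μ] = 0
  uncorr_v : ∀ k i j, cov[fun ω => x₀ ω i, fun ω => v k ω j; μ] = 0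

/-- The processes `x, y, x̂, u, δ` form the closed loop of the plant with the rollout policy with
terminal cost matrix `Pt`, window length `h` and actuation price `θ`. Here `φ l` is the pattern
selected at time `l h`: any minimizer of the lookahead cost (ties may be broken in any way that
depends on the available information only). -/
structure IsRolloutLoop {Ω : Type*} [MeasurableSpace Ω] (μ : Measure Ω) {nx nu ny : ℕ}
    (S : PlantData nx nu ny) (Pt : Matrix (Fin nx) (Fin nx) ℝ) (θ : ℝ) (h : ℕ)
    (x₀ : Ω → Vec nx) (w : ℕ → Ω → Vec nx) (v : ℕ → Ω → Vec ny)
    (x : ℕ → Ω → Vec nx) (y : ℕ → Ω → Vec ny) (xhat : ℕ → Ω → Vec nx)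
    (u : ℕ → Ω → Vec nu) (δ : ℕ → Ω → Bool) (φ : ℕ → Ω → Fin h → Bool) : Prop where
  init : x 0 = x₀
  state : ∀ k ω, x (k + 1) ω =
    S.A.toEuclideanLin (x k ω) + S.B.toEuclideanLin (u k ω) + w k ω
  output : ∀ k ω, y k ω = S.C.toEuclideanLin (x k ω) + v k ω
  /-- `x̂_k` is a version of the conditional expectation of `x_k` given the information. -/
  estimate_meas : ∀ k, Measurable[infoSigma y u δ k] (xhat k)
  estimate : ∀ k, xhat k =ᵐ[μ] μ[x k | infoSigma y u δ k]
  select_meas : ∀ l, Measurable[infoSigma y u δ (l * h)] (φ l)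
  select : ∀ l ω (m : Fin h → Bool),
    S.rolloutCost Pt θ (φ l ω) (l * h) (xhat (l * h) ω) ≤
      S.rolloutCost Pt θ m (l * h) (xhat (l * h) ω)
  trigger : ∀ l (s : Fin h) ω, δ (l * h + s) ω = φ l ω s
  control : ∀ l (s : Fin h) ω, u (l * h + s) ω =
    if φ l ω s then (S.rolloutF Pt (φ l ω) s).toEuclideanLin (xhat (l * h + s) ω) else 0

end

/-!
Mean-square stability follows from a quadratic Lyapunov function that the rollout policy contracts
from window to window, up to a disturbance that is bounded in mean square.

*Estimation error.* As `C` has a left inverse `G`, `x = G y - G v` with `G y` known from the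
information, so the error `x - x̂` is the error of estimating `G v`, whose second moment is bounded
(`IsRolloutLoop.exists_integral_error_sq_le`). Hence `x̂` follows the plant dynamics with a
disturbance `ξ` bounded in mean square (`IsRolloutLoop.exists_integral_innovation_sq_le`).

*Lyapunov function.* `V z = zᵀ Pt z` at the beginnings of the windows. The base policy is one of the
patterns, and because `Pt` solves the periodic Riccati equation its quadratic cost over a window is
`V` itself (`PlantData.rolloutP_basePattern`). The stationary covariance makes the remaining parts
of the lookahead costs constant in time, so the selected pattern costs at most `V z + K` with a
uniform `K` (`PlantData.exists_quadForm_le_of_rolloutCost_le`). Along the window the cost-to-go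
drops by the stage costs, in particular by `zᵀ Q z ≥ ε V z` at the first step, and the disturbances
enter through Young's inequality. This gives `V z⁺ ≤ r V z + c (1 + ∑ ‖ξ‖²)` with `r < 1`
(`PlantData.exists_window_contraction`), and taking expectations bounds `x̂`, hence `x = x̂ + (x - x̂)`.

*Existence of `Pt`.* The periodic Riccati equation is a fixed point equation for `p` steps of the
ordinary Riccati recursion (`PlantData.isPeriodicRiccatiSolution_iff`). Value iteration from `0` is
monotone, and bounded because every state of the sampled pair `(A ^ p, A ^ (p - 1) * B)` can be
steered to the origin (`exists_null_control`). For the latter, a left eigenvector of `A ^ p` with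
nonzero eigenvalue is a left eigenvector of `A` by the eigenvalue condition, so orthogonality to
`A ^ (p - 1) * B` would contradict controllability of `(A, B)`; therefore `A ^ p` acts nilpotently
on the annihilator of the reachable space.
-/

open Filter Topology

/-! ### Quadratic forms -/

/-- The quadratic form `xᵀ M x` on coordinate vectors; `quadForm M x` is `qform M x.ofLp`. -/
def qform {n : ℕ} (M : Matrix (Fin n) (Fin n) ℝ) (x : Fin n → ℝ) : ℝ := x ⬝ᵥ (M *ᵥ x)

theorem qform_add_matrix {n : ℕ} (M N : Matrix (Fin n) (Fin n) ℝ) (x : Fin n → ℝ) :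
    qform (M + N) x = qform M x + qform N x := by
  simp [qform, add_mulVec, dotProduct_add]

theorem qform_sub_matrix {n : ℕ} (M N : Matrix (Fin n) (Fin n) ℝ) (x : Fin n → ℝ) :
    qform (M - N) x = qform M x - qform N x := by
  simp [qform, sub_mulVec, dotProduct_sub]

theorem qform_zero_matrix {n : ℕ} (x : Fin n → ℝ) :
    qform (0 : Matrix (Fin n) (Fin n) ℝ) x = 0 := by
  simp [qform]

theorem qform_zero {n : ℕ} (M : Matrix (Fin n) (Fin n) ℝ) : qform M 0 = 0 := by
  simp [qform]

theorem qform_congr {n m : ℕ} (M : Matrix (Fin n) (Fin n) ℝ) (A : Matrix (Fin n) (Fin m) ℝ)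
    (x : Fin m → ℝ) : qform (Aᵀ * M * A) x = qform M (A *ᵥ x) := by
  simp only [qform, ← mulVec_mulVec]
  rw [dotProduct_mulVec, vecMul_transpose]

theorem qform_nonneg {n : ℕ} {M : Matrix (Fin n) (Fin n) ℝ} (hM : M.PosSemidef)
    (x : Fin n → ℝ) : 0 ≤ qform M x := by
  simpa [qform] using hM.dotProduct_mulVec_nonneg x

theorem qform_pos {n : ℕ} {M : Matrix (Fin n) (Fin n) ℝ} (hM : M.PosDef)
    {x : Fin n → ℝ} (hx : x ≠ 0) : 0 < qform M x := by
  simpa [qform] using hM.dotProduct_mulVec_pos hx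

theorem dotProduct_mulVec_comm_of_isHermitian {n : ℕ} {M : Matrix (Fin n) (Fin n) ℝ}
    (hM : M.IsHermitian) (x y : Fin n → ℝ) : x ⬝ᵥ (M *ᵥ y) = y ⬝ᵥ (M *ᵥ x) := by
  have h : Mᵀ = M := (conjTranspose_eq_transpose_of_trivial M).symm.trans hM
  rw [dotProduct_mulVec, dotProduct_comm, ← mulVec_transpose, h]

theorem qform_add {n : ℕ} {M : Matrix (Fin n) (Fin n) ℝ} (hM : M.IsHermitian)
    (x y : Fin n → ℝ) : qform M (x + y) = qform M x + 2 * (x ⬝ᵥ (M *ᵥ y)) + qform M y := by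
  simp only [qform, mulVec_add, dotProduct_add, add_dotProduct,
    dotProduct_mulVec_comm_of_isHermitian hM y x]
  ring

theorem qform_smul {n : ℕ} (M : Matrix (Fin n) (Fin n) ℝ) (c : ℝ) (x : Fin n → ℝ) :
    qform M (c • x) = c ^ 2 * qform M x := by
  simp [qform, mulVec_smul]
  ring

/-- Young's inequality for a positive semidefinite quadratic form. -/
theorem qform_add_le {n : ℕ} {M : Matrix (Fin n) (Fin n) ℝ} (hM : M.PosSemidef) {η : ℝ}
    (hη : 0 < η) (x y : Fin n → ℝ) :
    qform M (x + y) ≤ (1 + η) * qform M x + (1 + η⁻¹) * qform M y := by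
  have h := qform_nonneg hM (η • x + (-1 : ℝ) • y)
  rw [qform_add hM.isHermitian, qform_smul, qform_smul] at h
  simp only [mulVec_smul, smul_dotProduct, dotProduct_smul, smul_eq_mul] at h
  rw [qform_add hM.isHermitian]
  have h2 : 0 ≤ η⁻¹ * (η ^ 2 * qform M x - 2 * η * (x ⬝ᵥ (M *ᵥ y)) + qform M y) := by
    apply mul_nonneg (by positivity)
    linarith
  have h3 : η⁻¹ * (η ^ 2 * qform M x - 2 * η * (x ⬝ᵥ (M *ᵥ y)) + qform M y)
      = η * qform M x - 2 * (x ⬝ᵥ (M *ᵥ y)) + η⁻¹ * qform M y := by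
    field_simp
  rw [h3] at h2
  linarith

/-- A symmetric matrix is recovered from its quadratic form by polarization. -/
theorem apply_eq_qform {n : ℕ} {M : Matrix (Fin n) (Fin n) ℝ} (hM : M.IsHermitian)
    (i j : Fin n) : M i j =
      (qform M (Pi.single i 1 + Pi.single j 1) - qform M (Pi.single i 1)
        - qform M (Pi.single j 1)) / 2 := by
  rw [qform_add hM]
  simp only [mulVec_single_one, single_one_dotProduct, col_apply]
  ring

theorem continuous_qform {n : ℕ} (M : Matrix (Fin n) (Fin n) ℝ) : Continuous (qform M) := by
  unfold qform
  fun_prop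

theorem quadForm_eq_qform {n : ℕ} (M : Matrix (Fin n) (Fin n) ℝ) (x : Vec n) :
    quadForm M x = qform M x.ofLp := rfl

theorem continuous_quadForm {n : ℕ} (M : Matrix (Fin n) (Fin n) ℝ) :
    Continuous (quadForm M) :=
  (continuous_qform M).comp (PiLp.continuous_ofLp 2 _)

theorem quadForm_smul {n : ℕ} (M : Matrix (Fin n) (Fin n) ℝ) (c : ℝ) (x : Vec n) :
    quadForm M (c • x) = c ^ 2 * quadForm M x := by
  simp [quadForm_eq_qform, qform_smul]

theorem exists_quadForm_le {n : ℕ} (M : Matrix (Fin n) (Fin n) ℝ) :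
    ∃ c : ℝ, 0 < c ∧ ∀ x : Vec n, quadForm M x ≤ c * ‖x‖ ^ 2 := by
  obtain ⟨c, hc⟩ := (isCompact_sphere (0 : Vec n) 1).bddAbove_image
    (continuous_quadForm M).continuousOn
  refine ⟨|c| + 1, by positivity, fun x => ?_⟩
  rcases eq_or_ne x 0 with rfl | hx
  · simp [quadForm]
  · have hn : ‖x‖ ≠ 0 := norm_ne_zero_iff.mpr hx
    have h1 : quadForm M (‖x‖⁻¹ • x) ≤ c := hc ⟨‖x‖⁻¹ • x, by simp [norm_smul, hn], rfl⟩
    have h2 : quadForm M x = ‖x‖ ^ 2 * quadForm M (‖x‖⁻¹ • x) := by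
      rw [quadForm_smul]
      field_simp
    rw [h2, mul_comm]
    gcongr
    linarith [le_abs_self c]

theorem exists_le_quadForm {n : ℕ} {M : Matrix (Fin n) (Fin n) ℝ} (hM : M.PosDef) :
    ∃ c : ℝ, 0 < c ∧ ∀ x : Vec n, c * ‖x‖ ^ 2 ≤ quadForm M x := by
  have hpos : ∀ x ∈ Metric.sphere (0 : Vec n) 1, 0 < quadForm M x := by
    intro x hx
    apply qform_pos hM
    intro h0
    have : x = 0 := by
      ext i
      simpa using congrFun h0 i
    simp [this] at hx
  obtain ⟨c, hc0, hc⟩ : ∃ c : ℝ, 0 < c ∧ ∀ x ∈ Metric.sphere (0 : Vec n) 1,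
      c ≤ quadForm M x := by
    rcases (Metric.sphere (0 : Vec n) 1).eq_empty_or_nonempty with he | hne
    · exact ⟨1, one_pos, by simp [he]⟩
    · obtain ⟨y, hy, hmin⟩ := (isCompact_sphere (0 : Vec n) 1).exists_isMinOn hne
        (continuous_quadForm M).continuousOn
      exact ⟨quadForm M y, hpos y hy, fun x hx => hmin hx⟩
  refine ⟨c, hc0, fun x => ?_⟩
  rcases eq_or_ne x 0 with rfl | hx
  · simp [quadForm]
  · have hn : ‖x‖ ≠ 0 := norm_ne_zero_iff.mpr hx
    have h1 : c ≤ quadForm M (‖x‖⁻¹ • x) := hc _ (by simp [norm_smul, hn])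
    have h2 : quadForm M x = ‖x‖ ^ 2 * quadForm M (‖x‖⁻¹ • x) := by
      rw [quadForm_smul]
      field_simp
    rw [h2, mul_comm]
    gcongr

/-! ### The Riccati step as a minimization -/

namespace PlantData

variable {nx nu ny : ℕ} (S : PlantData nx nu ny)

theorem actuationWeight_posDef (hR : S.R.PosDef) {P : Matrix (Fin nx) (Fin nx) ℝ}
    (hP : P.PosSemidef) : (S.Bᵀ * P * S.B + S.R).PosDef := by
  refine PosDef.posSemidef_add ?_ hR
  simpa using hP.conjTranspose_mul_mul_same S.B

theorem qform_riccatiStep_false (P : Matrix (Fin nx) (Fin nx) ℝ) (x : Fin nx → ℝ) :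
    qform (S.riccatiStep false P) x = qform S.Q x + qform P (S.A *ᵥ x) := by
  simp [riccatiStep, qform_add_matrix, qform_congr]

/-- Completion of squares: the one-step cost of an input `u` exceeds the Riccati value by the
quadratic form of the deviation of `u` from the optimal feedback. -/
theorem completion_of_squares (hR : S.R.PosDef) {P : Matrix (Fin nx) (Fin nx) ℝ}
    (hP : P.PosSemidef) (x : Fin nx → ℝ) (u : Fin nu → ℝ) :
    qform S.Q x + qform S.R u + qform P (S.A *ᵥ x + S.B *ᵥ u) =
      qform (S.riccatiStep true P) x + qform (S.Bᵀ * P * S.B + S.R)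
        (u + ((S.Bᵀ * P * S.B + S.R)⁻¹ * S.Bᵀ * P * S.A) *ᵥ x) := by
  have hG := S.actuationWeight_posDef hR hP
  set G := S.Bᵀ * P * S.B + S.R with hGdef
  have hdet : IsUnit G.det := (isUnit_iff_isUnit_det _).1 hG.isUnit
  have hPt : Pᵀ = P := (conjTranspose_eq_transpose_of_trivial P).symm.trans hP.isHermitian
  have hGu : qform G u = qform S.R u + qform P (S.B *ᵥ u) := by
    rw [hGdef, qform_add_matrix, qform_congr]
    ring
  set z := (S.Bᵀ * P * S.A) *ᵥ x with hz
  have hF : (G⁻¹ * S.Bᵀ * P * S.A) *ᵥ x = G⁻¹ *ᵥ z := by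
    simp [hz, mulVec_mulVec, Matrix.mul_assoc]
  have hcross : (S.A *ᵥ x) ⬝ᵥ (P *ᵥ (S.B *ᵥ u)) = u ⬝ᵥ z := by
    rw [dotProduct_mulVec_comm_of_isHermitian hP.isHermitian, hz,
      Matrix.mul_assoc, ← mulVec_mulVec x S.Bᵀ, dotProduct_mulVec u, vecMul_transpose,
      ← mulVec_mulVec]
  have hGG : G *ᵥ (G⁻¹ *ᵥ z) = z := by
    rw [mulVec_mulVec, mul_nonsing_inv _ hdet, one_mulVec]
  have hquad : qform (S.Aᵀ * P * S.B * G⁻¹ * S.Bᵀ * P * S.A) x = qform G (G⁻¹ *ᵥ z) := by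
    have h1 : S.Aᵀ * P * S.B * G⁻¹ * S.Bᵀ * P * S.A =
        (S.Bᵀ * P * S.A)ᵀ * G⁻¹ * (S.Bᵀ * P * S.A) := by
      simp [Matrix.mul_assoc, hPt]
    rw [h1, qform_congr, ← hz]
    simp only [qform]
    rw [hGG, dotProduct_comm]
  rw [qform_add hP.isHermitian, hF, qform_add hG.isHermitian, hGG, hGu, hcross]
  simp only [riccatiStep, if_true, qform_sub_matrix, qform_add_matrix, ← hGdef, hquad,
    qform_congr]
  ring

theorem qform_riccatiStep_true_le (hR : S.R.PosDef) {P : Matrix (Fin nx) (Fin nx) ℝ}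
    (hP : P.PosSemidef) (x : Fin nx → ℝ) (u : Fin nu → ℝ) :
    qform (S.riccatiStep true P) x ≤
      qform S.Q x + qform S.R u + qform P (S.A *ᵥ x + S.B *ᵥ u) := by
  rw [S.completion_of_squares hR hP]
  linarith [qform_nonneg (S.actuationWeight_posDef hR hP).posSemidef
    (u + ((S.Bᵀ * P * S.B + S.R)⁻¹ * S.Bᵀ * P * S.A) *ᵥ x)]

/-- The Riccati value is attained by the optimal feedback. -/
theorem qform_riccatiStep_true_eq (hR : S.R.PosDef) {P : Matrix (Fin nx) (Fin nx) ℝ}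
    (hP : P.PosSemidef) (x : Fin nx → ℝ) {u : Fin nu → ℝ}
    (hu : u = -((S.Bᵀ * P * S.B + S.R)⁻¹ * S.Bᵀ * P * S.A) *ᵥ x) :
    qform (S.riccatiStep true P) x =
      qform S.Q x + qform S.R u + qform P (S.A *ᵥ x + S.B *ᵥ u) := by
  rw [S.completion_of_squares hR hP, hu]
  simp [neg_mulVec, qform_zero]

/-- Whether or not the step acts, the Riccati value is the cost of a suitable input. -/
theorem exists_qform_riccatiStep_eq (hR : S.R.PosDef) {P : Matrix (Fin nx) (Fin nx) ℝ}
    (hP : P.PosSemidef) (b : Bool) (x : Fin nx → ℝ) :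
    ∃ u : Fin nu → ℝ, (b = false → u = 0) ∧ qform (S.riccatiStep b P) x =
      qform S.Q x + qform S.R u + qform P (S.A *ᵥ x + S.B *ᵥ u) := by
  cases b
  · exact ⟨0, fun _ => rfl, by simp [qform_riccatiStep_false, qform_zero]⟩
  · exact ⟨_, by simp, S.qform_riccatiStep_true_eq hR hP x rfl⟩

theorem riccatiStep_isHermitian (hQ : S.Q.IsHermitian) (hR : S.R.IsHermitian)
    {P : Matrix (Fin nx) (Fin nx) ℝ} (hP : P.IsHermitian) (b : Bool) :
    (S.riccatiStep b P).IsHermitian := by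
  have hQt : S.Qᵀ = S.Q := (conjTranspose_eq_transpose_of_trivial S.Q).symm.trans hQ
  have hRt : S.Rᵀ = S.R := (conjTranspose_eq_transpose_of_trivial S.R).symm.trans hR
  have hPt : Pᵀ = P := (conjTranspose_eq_transpose_of_trivial P).symm.trans hP
  rw [IsHermitian, conjTranspose_eq_transpose_of_trivial]
  cases b <;>
  simp [riccatiStep, transpose_nonsing_inv, Matrix.mul_assoc, hQt, hRt, hPt]

theorem qform_Q_le_riccatiStep (hR : S.R.PosDef) {P : Matrix (Fin nx) (Fin nx) ℝ}
    (hP : P.PosSemidef) (b : Bool) (x : Fin nx → ℝ) :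
    qform S.Q x ≤ qform (S.riccatiStep b P) x := by
  obtain ⟨u, -, h⟩ := S.exists_qform_riccatiStep_eq hR hP b x
  rw [h]
  linarith [qform_nonneg hR.posSemidef u, qform_nonneg hP (S.A *ᵥ x + S.B *ᵥ u)]

theorem riccatiStep_posDef (hQ : S.Q.PosDef) (hR : S.R.PosDef)
    {P : Matrix (Fin nx) (Fin nx) ℝ} (hP : P.PosSemidef) (b : Bool) :
    (S.riccatiStep b P).PosDef :=
  PosDef.of_dotProduct_mulVec_pos
    (S.riccatiStep_isHermitian hQ.isHermitian hR.isHermitian hP.isHermitian b) fun x hx => by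
      simpa [qform] using (qform_pos hQ hx).trans_le (S.qform_Q_le_riccatiStep hR hP b x)

theorem riccatiStep_mono (hR : S.R.PosDef) {P P' : Matrix (Fin nx) (Fin nx) ℝ}
    (hP : P.PosSemidef) (hP' : P'.PosSemidef) (hle : ∀ x, qform P x ≤ qform P' x) (b : Bool)
    (x : Fin nx → ℝ) : qform (S.riccatiStep b P) x ≤ qform (S.riccatiStep b P') x := by
  obtain ⟨u, hu, h⟩ := S.exists_qform_riccatiStep_eq hR hP' b x
  rw [h]
  cases b
  · rw [hu rfl, qform_riccatiStep_false]
    simpa [qform_zero] using hle _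
  · linarith [S.qform_riccatiStep_true_le hR hP x u, hle (S.A *ᵥ x + S.B *ᵥ u)]

end PlantData

/-! ### Null controllability of the sampled pair `(A ^ p, A ^ (p - 1) * B)` -/

/-- If a product of distinct linear factors in `f` kills `v ≠ 0`, and at most one of the
corresponding scalars is an eigenvalue of `f`, then `v` is itself an eigenvector: the other factors
are injective and cancel. -/
theorem exists_eigenvector_of_prod_eq_zero {ι V : Type*} [AddCommGroup V] [Module ℂ V]
    (f : Module.End ℂ V) (g : ι → ℂ) (s : Finset ι) (hg : Set.InjOn g s)
    (huniq : ∀ i ∈ s, ∀ j ∈ s, ∀ v w : V, v ≠ 0 → w ≠ 0 → f v = g i • v → f w = g j • w →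
      g i = g j) (v : V) (hv : v ≠ 0)
    (h : Polynomial.aeval f (∏ i ∈ s, (Polynomial.X - Polynomial.C (g i))) v = 0) :
    ∃ i ∈ s, f v = g i • v := by
  classical
  induction s using Finset.induction_on generalizing v with
  | empty => simp at h; exact absurd h hv
  | insert a t ha ih =>
    rw [Finset.prod_insert ha, mul_comm, map_mul, Module.End.mul_apply] at h
    have hlin : ∀ z, Polynomial.aeval f (Polynomial.X - Polynomial.C (g a)) z
        = f z - g a • z := by
      intro z
      simp [Module.algebraMap_end_apply]
    rw [hlin] at h
    by_cases hw : f v - g a • v = 0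
    · exact ⟨a, Finset.mem_insert_self _ _, sub_eq_zero.mp hw⟩
    obtain ⟨i, hi, hfi⟩ := ih (hg.mono (by simp))
      (fun i hi j hj => huniq i (Finset.mem_insert_of_mem hi) j (Finset.mem_insert_of_mem hj))
      _ hw h
    refine ⟨i, Finset.mem_insert_of_mem hi, ?_⟩
    -- `f v - g i • v` would be an eigenvector for `g a ≠ g i`.
    by_contra hne
    have hw' : f v - g i • v ≠ 0 := sub_ne_zero.mpr hne
    have hfa : f (f v - g i • v) = g a • (f v - g i • v) := by
      simp only [map_sub, map_smul, smul_sub] at hfi ⊢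
      rw [smul_comm (g a) (g i) v]
      have := sub_eq_zero.mpr hfi
      rw [← sub_eq_zero, ← this, smul_comm (g i) (g a) v]
      abel
    have hEq := huniq a (Finset.mem_insert_self _ _) i (Finset.mem_insert_of_mem hi)
      _ _ hw' hw hfa hfi
    exact ha (hg (by simp) (by simp [hi]) hEq ▸ hi)

theorem hasEigenvalue_of_vecMul {n : ℕ} (A : Matrix (Fin n) (Fin n) ℂ) {v : Fin n → ℂ}
    (hv : v ≠ 0) {l : ℂ} (h : v ᵥ* A = l • v) :
    Module.End.HasEigenvalue (Matrix.toLin' A) l := by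
  have h0 : v ᵥ* (A - l • 1) = 0 := by
    rw [vecMul_sub, vecMul_smul, vecMul_one, h, sub_self]
  obtain ⟨w, hw, hw0⟩ := exists_mulVec_eq_zero_iff.mpr (exists_vecMul_eq_zero_iff.mp ⟨v, hv, h0⟩)
  refine Module.End.hasEigenvalue_of_hasEigenvector (x := w)
    (Module.End.hasEigenvector_iff.mpr ⟨Module.End.mem_eigenspace_iff.mpr ?_, hw⟩)
  rw [sub_mulVec, smul_mulVec, one_mulVec, sub_eq_zero] at hw0
  simpa using hw0

theorem pow_vecMulLinear {n : ℕ} {R : Type*} [CommRing R] (A : Matrix (Fin n) (Fin n) R) (k : ℕ)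
    (v : Fin n → R) :
    ((vecMulLinear A : Module.End R (Fin n → R)) ^ k) v = v ᵥ* A ^ k := by
  induction k generalizing v with
  | zero => simp
  | succ k ih => rw [pow_succ, Module.End.mul_apply, ih, pow_succ', ← vecMul_vecMul]; simp

/-- Under the eigenvalue condition, a left eigenvector of `A ^ p` with nonzero eigenvalue is a left
eigenvector of `A`. -/
theorem EigenvalueCondition.exists_vecMul_eq_smul {n p : ℕ} (hp : 0 < p)
    {A : Matrix (Fin n) (Fin n) ℝ} (hA : EigenvalueCondition A p) {v : Fin n → ℂ} (hv : v ≠ 0)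
    {c : ℂ} (hc : c ≠ 0) (h : v ᵥ* (A.map (algebraMap ℝ ℂ)) ^ p = c • v) :
    ∃ l : ℂ, l ^ p = c ∧ v ᵥ* A.map (algebraMap ℝ ℂ) = l • v := by
  obtain ⟨a, ha⟩ := IsAlgClosed.exists_pow_nat_eq c hp
  have ha0 : a ≠ 0 := by
    rintro rfl
    rw [zero_pow hp.ne'] at ha
    exact hc ha.symm
  have : NeZero p := ⟨hp.ne'⟩
  have hprim := Complex.isPrimitiveRoot_exp p hp.ne'
  have hprod := X_pow_sub_C_eq_prod hprim hp ha
  set ω := Complex.exp (2 * Real.pi * Complex.I / p)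
  set M := A.map (algebraMap ℝ ℂ) with hM
  have hz : Polynomial.aeval (vecMulLinear M : Module.End ℂ (Fin n → ℂ))
      (Polynomial.X ^ p - Polynomial.C c) v = 0 := by
    rw [map_sub, map_pow, Polynomial.aeval_X, Polynomial.aeval_C, LinearMap.sub_apply,
      pow_vecMulLinear, h, Module.algebraMap_end_apply, sub_self]
  rw [hprod] at hz
  have hroot : ∀ i : ℕ, (ω ^ i) ^ p = 1 := fun i => by
    rw [← pow_mul, mul_comm, pow_mul, hprim.pow_eq_one, one_pow]
  have huniq : ∀ i ∈ Finset.range p, ∀ j ∈ Finset.range p, ∀ v w : Fin n → ℂ, v ≠ 0 → w ≠ 0 →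
      vecMulLinear M v = (ω ^ i * a) • v → vecMulLinear M w = (ω ^ j * a) • w →
      ω ^ i * a = ω ^ j * a := by
    intro i _ j _ v w hv hw hfv hfw
    obtain ⟨hζ, hξ⟩ := And.intro (hroot i) (hroot j)
    set ζ := ω ^ i
    set ξ := ω ^ j
    by_contra hne
    have hξ0 : ξ ≠ 0 := by
      intro h0
      simp [h0, hp.ne'] at hξ
    have hquot : (ζ / ξ) ^ p = 1 := by rw [div_pow, hζ, hξ, div_one]
    have hunit : (Units.mk0 (ζ / ξ) (by rintro h0; simp [h0, hp.ne'] at hquot)) ∈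
        rootsOfUnity p ℂ := by
      rw [_root_.mem_rootsOfUnity]
      ext
      simpa using hquot
    obtain ⟨q, -, hq⟩ := (Complex.mem_rootsOfUnity p _).mp hunit
    refine hA (ζ * a) (ξ * a) (hasEigenvalue_of_vecMul M hv (by simpa using hfv))
      (hasEigenvalue_of_vecMul M hw (by simpa using hfw)) hne q ?_
    have harg : (2 * Real.pi * ((q : ℤ) : ℂ) * Complex.I / p : ℂ)
        = 2 * Real.pi * Complex.I * (q / p) := by
      push_cast
      ring
    rw [harg, hq]
    simp only [Units.val_mk0]
    field_simp
  obtain ⟨i, -, hfv⟩ := exists_eigenvector_of_prod_eq_zero _ (fun i => ω ^ i * a) _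
    (fun i hi j hj hij => hprim.injOn_pow (by simpa using hi) (by simpa using hj)
      (mul_right_cancel₀ ha0 hij)) huniq v hv hz
  exact ⟨ω ^ i * a, by rw [mul_pow, hroot i, one_mul, ha], by simpa using hfv⟩

/-- The Popov–Belevitch–Hautus test: a left eigenvector of `A` orthogonal to `B` contradicts
controllability. -/
theorem IsControllablePair.eq_zero_of_vecMul {n m : ℕ} {A : Matrix (Fin n) (Fin n) ℝ}
    {B : Matrix (Fin n) (Fin m) ℝ} (hAB : IsControllablePair A B) {v : Fin n → ℂ} {l : ℂ}
    (hvA : v ᵥ* A.map (algebraMap ℝ ℂ) = l • v) (hvB : v ᵥ* B.map (algebraMap ℝ ℂ) = 0) :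
    v = 0 := by
  have hk : ∀ k : ℕ, v ᵥ* (A ^ k * B).map (algebraMap ℝ ℂ) = 0 := by
    intro k
    have hpow : v ᵥ* (A.map (algebraMap ℝ ℂ)) ^ k = l ^ k • v := by
      induction k with
      | zero => simp
      | succ k ih => rw [pow_succ, ← vecMul_vecMul, ih, smul_vecMul, hvA, smul_smul, pow_succ]
    rw [Matrix.map_mul, Matrix.map_pow, ← vecMul_vecMul, hpow, smul_vecMul, hvB, smul_zero]
  -- the controllability matrix is onto, so no real vector annihilates it
  have key : ∀ r : Fin n → ℝ, (∀ k : ℕ, r ᵥ* (A ^ k * B) = 0) → r = 0 := by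
    intro r hr
    set K : Matrix (Fin n) (Fin n × Fin m) ℝ :=
      Matrix.of fun i kj => (A ^ (kj.1 : ℕ) * B) i kj.2 with hK
    have hsurj : Function.Surjective K.mulVecLin := by
      rw [← LinearMap.range_eq_top]
      apply Submodule.eq_top_of_finrank_eq
      have : K.rank = n := hAB
      rw [Module.finrank_fin_fun]
      exact this
    obtain ⟨z, hz⟩ := hsurj r
    have hrK : r ᵥ* K = 0 := by
      ext ⟨k, j⟩
      simpa [vecMul, dotProduct, hK] using congrFun (hr k) j
    have : r ⬝ᵥ r = 0 := by
      nth_rewrite 2 [← hz]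
      rw [mulVecLin_apply, dotProduct_mulVec, hrK, zero_dotProduct]
    exact dotProduct_self_eq_zero.mp this
  have hre : (fun i => (v i).re) = 0 := by
    refine key _ fun k => ?_
    ext j
    have := congrArg Complex.re (congrFun (hk k) j)
    simpa [vecMul, dotProduct] using this
  have him : (fun i => (v i).im) = 0 := by
    refine key _ fun k => ?_
    ext j
    have := congrArg Complex.im (congrFun (hk k) j)
    simpa [vecMul, dotProduct] using this
  ext i
  exact Complex.ext (congrFun hre i) (congrFun him i)

/-- An endomorphism of a finite-dimensional complex space whose only eigenvalue is zero is
nilpotent. -/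
theorem isNilpotent_of_eigenvalue_eq_zero {V : Type*} [AddCommGroup V] [Module ℂ V]
    [FiniteDimensional ℂ V] (f : Module.End ℂ V)
    (h : ∀ (c : ℂ) (v : V), v ≠ 0 → f v = c • v → c = 0) : IsNilpotent f := by
  have hbot : ∀ c : ℂ, c ≠ 0 → f.maxGenEigenspace c = ⊥ := by
    intro c hc
    rw [eq_bot_iff]
    intro v hv
    obtain ⟨k, hk⟩ := (f.mem_maxGenEigenspace c v).mp hv
    have hinj : Function.Injective (f - c • (1 : Module.End ℂ V)) := by
      rw [injective_iff_map_eq_zero]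
      intro w hw
      by_contra hw0
      refine hc (h c w hw0 ?_)
      simpa [sub_eq_zero] using hw
    have hinjk : Function.Injective ⇑((f - c • (1 : Module.End ℂ V)) ^ k) := by
      rw [Module.End.coe_pow]
      exact hinj.iterate k
    exact hinjk (by simpa using hk)
  have htop : f.maxGenEigenspace 0 = ⊤ := by
    rw [eq_top_iff, ← Module.End.iSup_maxGenEigenspace_eq_top f]
    refine iSup_le fun c => ?_
    rcases eq_or_ne c 0 with rfl | hc
    · exact le_rfl
    · simp [hbot c hc]
  refine ⟨Module.finrank ℂ V, LinearMap.ext fun v => ?_⟩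
  have hv : v ∈ f.maxGenEigenspace 0 := htop ▸ Submodule.mem_top
  rw [Module.End.maxGenEigenspace_eq_genEigenspace_finrank, Module.End.mem_genEigenspace_nat] at hv
  simpa using hv

/-- The row vectors that annihilate the reachable directions of `(A ^ p, A ^ (p - 1) * B)` are killed
by every large power of `A ^ p`. -/
theorem exists_pow_vecMul_eq_zero {n m p : ℕ} (hp : 0 < p) {A : Matrix (Fin n) (Fin n) ℝ}
    {B : Matrix (Fin n) (Fin m) ℝ} (hAB : IsControllablePair A B)
    (hA : EigenvalueCondition A p) :
    ∃ N : ℕ, ∀ k, N ≤ k → ∀ v : Fin n → ℝ, (∀ j, v ᵥ* ((A ^ p) ^ j * (A ^ (p - 1) * B)) = 0) →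
      v ᵥ* (A ^ p) ^ k = 0 := by
  set M := A.map (algebraMap ℝ ℂ) with hM
  set b := (A ^ (p - 1) * B).map (algebraMap ℝ ℂ) with hb
  let W : Submodule ℂ (Fin n → ℂ) :=
    { carrier := {v | ∀ j : ℕ, v ᵥ* ((M ^ p) ^ j * b) = 0}
      zero_mem' := by simp
      add_mem' := fun {x y} hx hy j => by rw [add_vecMul, hx j, hy j, add_zero]
      smul_mem' := fun c x hx j => by rw [smul_vecMul, hx j, smul_zero] }
  let f : Module.End ℂ (Fin n → ℂ) := vecMulLinear (M ^ p)
  have hf : ∀ v ∈ W, f v ∈ W := by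
    intro v hv j
    change (v ᵥ* M ^ p) ᵥ* _ = 0
    rw [vecMul_vecMul, ← Matrix.mul_assoc, ← pow_succ']
    exact hv (j + 1)
  have hnil : IsNilpotent (f.restrict hf) := by
    refine isNilpotent_of_eigenvalue_eq_zero _ fun c v hv hcv => ?_
    by_contra hc
    have hv0 : (v : Fin n → ℂ) ≠ 0 := by simpa using hv
    have hcv' : (v : Fin n → ℂ) ᵥ* M ^ p = c • (v : Fin n → ℂ) := congrArg Subtype.val hcv
    obtain ⟨l, hl, hvl⟩ := hA.exists_vecMul_eq_smul hp hv0 hc hcv'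
    have hl0 : l ≠ 0 := by
      rintro rfl
      exact hc (by rw [← hl, zero_pow hp.ne'])
    refine hv0 (hAB.eq_zero_of_vecMul hvl ?_)
    have hpow : ∀ k : ℕ, (v : Fin n → ℂ) ᵥ* M ^ k = l ^ k • (v : Fin n → ℂ) := by
      intro k
      induction k with
      | zero => simp
      | succ k ih => rw [pow_succ, ← vecMul_vecMul, ih, smul_vecMul, hvl, smul_smul, pow_succ]
    have h0 := v.2 0
    rw [pow_zero, Matrix.one_mul, hb, Matrix.map_mul, Matrix.map_pow, ← vecMul_vecMul, hpow,
      smul_vecMul] at h0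
    exact (smul_eq_zero.mp h0).resolve_left (pow_ne_zero _ hl0)
  obtain ⟨N, hN⟩ := hnil
  refine ⟨N, fun k hk v hv => ?_⟩
  have hvW : (fun i => (v i : ℂ)) ∈ W := by
    intro j
    have : (M ^ p) ^ j * b = ((A ^ p) ^ j * (A ^ (p - 1) * B)).map (algebraMap ℝ ℂ) := by
      simp only [hM, hb, Matrix.map_mul, Matrix.map_pow]
    rw [this]
    ext i
    have := congrArg (algebraMap ℝ ℂ) (congrFun (hv j) i)
    simpa [vecMul, dotProduct] using this
  have h1 : ((f.restrict hf) ^ k) ⟨_, hvW⟩ = 0 := by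
    rw [pow_eq_zero_of_le hk hN, LinearMap.zero_apply]
  rw [Module.End.pow_restrict] at h1
  have h2 : (fun i => (v i : ℂ)) ᵥ* (M ^ p) ^ k = 0 := by
    rw [← pow_vecMulLinear]
    exact congrArg Subtype.val h1
  have h3 : (M ^ p) ^ k = ((A ^ p) ^ k).map (algebraMap ℝ ℂ) := by
    simp only [hM, Matrix.map_pow]
  rw [h3] at h2
  ext i
  have := congrFun h2 i
  apply Complex.ofReal_injective
  simpa [vecMul, dotProduct] using this

/-- Every state of the sampled system `(A ^ p, A ^ (p - 1) * B)` is steered to the origin in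
finitely many steps. -/
theorem exists_null_control {n m p : ℕ} (hp : 0 < p) {A : Matrix (Fin n) (Fin n) ℝ}
    {B : Matrix (Fin n) (Fin m) ℝ} (hAB : IsControllablePair A B)
    (hA : EigenvalueCondition A p) (x : Fin n → ℝ) :
    ∃ (N : ℕ) (u : ℕ → Fin m → ℝ), (A ^ p) ^ N *ᵥ x =
      ∑ j ∈ Finset.range N, ((A ^ p) ^ j * (A ^ (p - 1) * B)) *ᵥ u j := by
  obtain ⟨N, hN⟩ := exists_pow_vecMul_eq_zero hp hAB hA
  let D : ℕ → Matrix (Fin n) (Fin m) ℝ := fun j => (A ^ p) ^ j * (A ^ (p - 1) * B)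
  let reach : ℕ →o Submodule ℝ (Fin n → ℝ) :=
    { toFun := fun k => ⨆ j ∈ Finset.range k, LinearMap.range (D j).mulVecLin
      monotone' := fun a b hab => biSup_mono fun j hj =>
        Finset.mem_range.mpr ((Finset.mem_range.mp hj).trans_le hab) }
  -- the reachable spaces stabilize, so a vector orthogonal to a late one is orthogonal to all
  obtain ⟨K, hK⟩ := monotone_stabilizes_iff_noetherian.mpr
    (inferInstance : IsNoetherian ℝ (Fin n → ℝ)) reach
  have hD : ∀ j w, D j *ᵥ w ∈ reach K := by
    intro j w
    rw [hK (max K (j + 1)) (le_max_left _ _)]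
    exact Submodule.mem_iSup_of_mem j (Submodule.mem_iSup_of_mem
      (Finset.mem_range.mpr ((Nat.lt_succ_self j).trans_le (le_max_right _ _))) ⟨w, rfl⟩)
  have hmem : (A ^ p) ^ (max N K) *ᵥ x ∈ reach (max N K) := by
    rw [← hK (max N K) (le_max_right _ _)]
    by_contra hx
    obtain ⟨g, hgx, hg⟩ := Submodule.exists_le_ker_of_notMem hx
    have hgdot : ∀ z, g z = (fun i => g (Pi.single i 1)) ⬝ᵥ z := by
      intro z
      conv_lhs => rw [← Finset.univ_sum_single z]
      rw [map_sum]
      refine Finset.sum_congr rfl fun i _ => ?_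
      rw [show Pi.single i (z i) = z i • (Pi.single i 1 : Fin n → ℝ) by
        rw [← Pi.single_smul', smul_eq_mul, mul_one], map_smul, smul_eq_mul, mul_comm]
    refine hgx ?_
    rw [hgdot, dotProduct_mulVec, hN _ (le_max_left _ _) _ (fun j => ?_), zero_dotProduct]
    refine dotProduct_eq_zero _ fun w => ?_
    rw [← dotProduct_mulVec, ← hgdot]
    exact hg (hD j w)
  obtain ⟨z, hsum⟩ := (Submodule.mem_iSup_finset_iff_exists_sum _ _).mp hmem
  choose u hu using fun j => (z j).2
  exact ⟨max N K, u, by rw [← hsum]; exact Finset.sum_congr rfl fun j _ => (hu j).symm⟩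

/-! ### Existence of a solution of the periodic Riccati equation -/

namespace PlantData

variable {nx nu ny : ℕ} (S : PlantData nx nu ny)

/-- The Riccati recursion over one period of the base policy: one step that may act, followed in
time by `p - 1` steps that do not. -/
noncomputable def periodMap (p : ℕ) (P : Matrix (Fin nx) (Fin nx) ℝ) : Matrix (Fin nx) (Fin nx) ℝ :=
  S.riccatiStep true ((S.riccatiStep false)^[p - 1] P)

theorem riccatiStep_false_iterate (P : Matrix (Fin nx) (Fin nx) ℝ) (j : ℕ) :
    (S.riccatiStep false)^[j] P =
      ∑ i ∈ Finset.range j, (S.A ^ i)ᵀ * S.Q * S.A ^ i + (S.A ^ j)ᵀ * P * S.A ^ j := by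
  induction j with
  | zero => simp
  | succ j ih =>
    rw [Function.iterate_succ_apply', ih, Finset.sum_range_succ']
    simp only [riccatiStep, Bool.false_eq_true, if_false, sub_zero, Matrix.mul_add,
      Matrix.add_mul, Matrix.mul_sum, Matrix.sum_mul, pow_succ, transpose_mul, pow_zero,
      transpose_one, Matrix.one_mul, Matrix.mul_one, Matrix.mul_assoc]
    abel

theorem qform_riccatiStep_false_iterate (P : Matrix (Fin nx) (Fin nx) ℝ) (j : ℕ)
    (z : Fin nx → ℝ) : qform ((S.riccatiStep false)^[j] P) z =
      ∑ i ∈ Finset.range j, qform S.Q (S.A ^ i *ᵥ z) + qform P (S.A ^ j *ᵥ z) := by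
  rw [riccatiStep_false_iterate, qform_add_matrix, qform_congr]
  congr 1
  simp only [← qform_congr]
  simp [qform, sum_mulVec, dotProduct_sum]

theorem iterate_riccatiStep_false_posSemidef (hQ : S.Q.PosDef) (hR : S.R.PosDef)
    {P : Matrix (Fin nx) (Fin nx) ℝ} (hP : P.PosSemidef) (j : ℕ) :
    ((S.riccatiStep false)^[j] P).PosSemidef := by
  induction j with
  | zero => exact hP
  | succ j ih =>
    rw [Function.iterate_succ_apply']
    exact (S.riccatiStep_posDef hQ hR ih false).posSemidef

theorem periodMap_posDef (hQ : S.Q.PosDef) (hR : S.R.PosDef) (p : ℕ)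
    {P : Matrix (Fin nx) (Fin nx) ℝ} (hP : P.PosSemidef) : (S.periodMap p P).PosDef :=
  S.riccatiStep_posDef hQ hR (S.iterate_riccatiStep_false_posSemidef hQ hR hP _) true

theorem periodMap_mono (hQ : S.Q.PosDef) (hR : S.R.PosDef) (p : ℕ)
    {P P' : Matrix (Fin nx) (Fin nx) ℝ} (hP : P.PosSemidef) (hP' : P'.PosSemidef)
    (hle : ∀ x, qform P x ≤ qform P' x) (x : Fin nx → ℝ) :
    qform (S.periodMap p P) x ≤ qform (S.periodMap p P') x := by
  refine S.riccatiStep_mono hR (S.iterate_riccatiStep_false_posSemidef hQ hR hP _)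
    (S.iterate_riccatiStep_false_posSemidef hQ hR hP' _) (fun z => ?_) true x
  simp only [qform_riccatiStep_false_iterate]
  gcongr
  exact hle _

/-- The periodic Riccati equation, whose coefficients lump a whole period together, is the fixed
point equation of the stepwise Riccati recursion over one period. -/
theorem isPeriodicRiccatiSolution_iff (hR : S.R.PosDef) (hQ : S.Q.PosDef) {p : ℕ} (hp : 0 < p)
    (P : Matrix (Fin nx) (Fin nx) ℝ) :
    S.IsPeriodicRiccatiSolution p P ↔ P.PosDef ∧ P = S.periodMap p P := by
  refine and_congr_right fun hP => ?_
  set P₁ := (S.riccatiStep false)^[p - 1] P with hP₁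
  have hP₁p : P₁.PosSemidef := S.iterate_riccatiStep_false_posSemidef hQ hR hP.posSemidef _
  have hP₁e := S.riccatiStep_false_iterate P (p - 1)
  rw [← hP₁] at hP₁e
  have hA : S.A ^ p = S.A ^ (p - 1) * S.A := by
    rw [← pow_succ, Nat.sub_add_cancel hp]
  have h1 : S.Qp p + (S.A ^ p)ᵀ * P * S.A ^ p = S.Q + S.Aᵀ * P₁ * S.A := by
    have h := S.riccatiStep_false_iterate P p
    rw [← Nat.sub_add_cancel hp, Function.iterate_succ_apply', ← hP₁, Nat.sub_add_cancel hp] at h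
    rw [Qp, ← h]
    simp [riccatiStep]
  have h2 : (S.Bp p)ᵀ * P * S.Bp p + S.Rp p = S.Bᵀ * P₁ * S.B + S.R := by
    rw [hP₁e, Bp, Rp, Finset.sum_Ico_eq_sum_range]
    simp only [Nat.add_sub_cancel_left, Matrix.mul_add, Matrix.add_mul, Matrix.mul_sum,
      Matrix.sum_mul, transpose_mul, Matrix.mul_assoc]
    abel
  have h3 : (S.Bp p)ᵀ * P * S.A ^ p + (S.Sp p)ᵀ = S.Bᵀ * P₁ * S.A := by
    have hQt : S.Qᵀ = S.Q :=
      (conjTranspose_eq_transpose_of_trivial S.Q).symm.trans hQ.isHermitian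
    rw [hP₁e, Bp, Sp, Finset.sum_Ico_eq_sum_range, hA]
    simp only [add_comm 1, Nat.add_sub_cancel, pow_succ, Matrix.mul_add, Matrix.add_mul,
      Matrix.mul_sum, Matrix.sum_mul, transpose_mul, transpose_sum, Matrix.mul_assoc, hQt]
    abel
  have hG := S.actuationWeight_posDef hR hP₁p
  have hgain : (S.periodicGain p P)ᵀ * ((S.Bp p)ᵀ * P * S.Bp p + S.Rp p) * S.periodicGain p P
      = S.Aᵀ * P₁ * S.B * (S.Bᵀ * P₁ * S.B + S.R)⁻¹ * S.Bᵀ * P₁ * S.A := by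
    rw [periodicGain, h2, h3]
    set G := S.Bᵀ * P₁ * S.B + S.R
    have hdet : IsUnit G.det := (isUnit_iff_isUnit_det _).1 hG.isUnit
    have hGt : Gᵀ = G := (conjTranspose_eq_transpose_of_trivial G).symm.trans hG.isHermitian
    have hPt : P₁ᵀ = P₁ :=
      (conjTranspose_eq_transpose_of_trivial P₁).symm.trans hP₁p.isHermitian
    simp only [Matrix.neg_mul, Matrix.mul_neg, transpose_neg, neg_neg, transpose_mul,
      transpose_transpose, transpose_nonsing_inv, hGt, hPt, Matrix.mul_assoc]
    rw [← Matrix.mul_assoc G, mul_nonsing_inv _ hdet, Matrix.one_mul]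
  rw [hgain, h1, periodMap, ← hP₁]
  simp [riccatiStep]

theorem continuousAt_riccatiStep (hR : S.R.PosDef) {P : Matrix (Fin nx) (Fin nx) ℝ}
    (hP : P.PosSemidef) (b : Bool) : ContinuousAt (S.riccatiStep b) P := by
  cases b
  · unfold riccatiStep
    simp only [Bool.false_eq_true, if_false]
    fun_prop
  · have hG := S.actuationWeight_posDef hR hP
    have hdet : (S.Bᵀ * P * S.B + S.R).det ≠ 0 :=
      ((isUnit_iff_isUnit_det _).1 hG.isUnit).ne_zero
    have hinv : ContinuousAt (fun P => (S.Bᵀ * P * S.B + S.R)⁻¹) P := by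
      refine ContinuousAt.comp (g := Inv.inv) (continuousAt_matrix_inv _ ?_) (by fun_prop)
      rw [Ring.inverse_eq_inv']
      exact continuousAt_inv₀ hdet
    unfold riccatiStep
    simp only [if_true]
    refine ContinuousAt.sub (by fun_prop) ?_
    let g (X : Matrix (Fin nx) (Fin nx) ℝ × Matrix (Fin nu) (Fin nu) ℝ) :=
      S.Aᵀ * X.1 * S.B * X.2 * S.Bᵀ * X.1 * S.A
    have hg : Continuous g := by fun_prop
    have hcomp := ContinuousAt.comp_of_eq (f := fun P' => (P', (S.Bᵀ * P' * S.B + S.R)⁻¹))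
      (g := g) (x := P) hg.continuousAt (continuousAt_id.prodMk hinv) rfl
    exact hcomp

theorem continuousAt_periodMap (hQ : S.Q.PosDef) (hR : S.R.PosDef) (p : ℕ)
    {P : Matrix (Fin nx) (Fin nx) ℝ} (hP : P.PosSemidef) : ContinuousAt (S.periodMap p) P := by
  have hcont : ∀ j, ContinuousAt (S.riccatiStep false)^[j] P := by
    intro j
    induction j with
    | zero => exact continuousAt_id
    | succ j ih =>
      rw [Function.iterate_succ']
      exact (S.continuousAt_riccatiStep hR
        (S.iterate_riccatiStep_false_posSemidef hQ hR hP j) false).comp ih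
  exact (S.continuousAt_riccatiStep hR
    (S.iterate_riccatiStep_false_posSemidef hQ hR hP (p - 1)) true).comp (hcont (p - 1))

/-- Value iteration for the periodic problem: the optimal cost over `N` periods. -/
noncomputable def valueIter (p N : ℕ) : Matrix (Fin nx) (Fin nx) ℝ := (S.periodMap p)^[N] 0

theorem valueIter_succ (p N : ℕ) :
    S.valueIter p (N + 1) = S.periodMap p (S.valueIter p N) :=
  Function.iterate_succ_apply' _ _ _

theorem valueIter_posSemidef (hQ : S.Q.PosDef) (hR : S.R.PosDef) (p N : ℕ) :
    (S.valueIter p N).PosSemidef := by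
  induction N with
  | zero => exact PosSemidef.zero
  | succ N ih =>
    rw [valueIter_succ]
    exact (S.periodMap_posDef hQ hR p ih).posSemidef

theorem monotone_qform_valueIter (hQ : S.Q.PosDef) (hR : S.R.PosDef) (p : ℕ)
    (x : Fin nx → ℝ) : Monotone fun N => qform (S.valueIter p N) x := by
  refine monotone_nat_of_le_succ fun N => ?_
  induction N generalizing x with
  | zero =>
    change qform 0 x ≤ _
    rw [qform_zero_matrix]
    exact qform_nonneg (S.valueIter_posSemidef hQ hR p 1) x
  | succ N ih =>
    rw [valueIter_succ, S.valueIter_succ p (N + 1)]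
    exact S.periodMap_mono hQ hR p (S.valueIter_posSemidef hQ hR p N)
      (S.valueIter_posSemidef hQ hR p (N + 1)) ih x

/-- If the value iteration stays bounded at a successor of `x`, then it stays bounded at `x`. -/
theorem bddAbove_valueIter_of_successor (hQ : S.Q.PosDef) (hR : S.R.PosDef) {p : ℕ}
    (hp : 0 < p) (x : Fin nx → ℝ) (u : Fin nu → ℝ)
    (h : ∃ c, ∀ N, qform (S.valueIter p N) (S.A ^ p *ᵥ x + (S.A ^ (p - 1) * S.B) *ᵥ u) ≤ c) :
    ∃ c, ∀ N, qform (S.valueIter p N) x ≤ c := by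
  obtain ⟨c, hc⟩ := h
  set z := S.A *ᵥ x + S.B *ᵥ u with hz
  have hAz : S.A ^ (p - 1) *ᵥ z = S.A ^ p *ᵥ x + (S.A ^ (p - 1) * S.B) *ᵥ u := by
    rw [hz, mulVec_add, mulVec_mulVec, mulVec_mulVec, ← pow_succ, Nat.sub_add_cancel hp]
  refine ⟨qform S.Q x + qform S.R u +
    (∑ i ∈ Finset.range (p - 1), qform S.Q (S.A ^ i *ᵥ z) + c), fun N => ?_⟩
  refine (S.monotone_qform_valueIter hQ hR p x (Nat.le_succ N)).trans ?_
  have h1 := S.qform_riccatiStep_true_le hR (S.iterate_riccatiStep_false_posSemidef hQ hR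
    (S.valueIter_posSemidef hQ hR p N) (p - 1)) x u
  rw [← hz, qform_riccatiStep_false_iterate, hAz] at h1
  simp only [Nat.succ_eq_add_one, valueIter_succ, periodMap]
  linarith [hc N]

theorem bddAbove_valueIter (hQ : S.Q.PosDef) (hR : S.R.PosDef) {p : ℕ} (hp : 0 < p)
    (hAB : IsControllablePair S.A S.B) (hA : EigenvalueCondition S.A p) (x : Fin nx → ℝ) :
    ∃ c, ∀ N, qform (S.valueIter p N) x ≤ c := by
  obtain ⟨N, u, hNu⟩ := exists_null_control hp hAB hA x
  induction N generalizing x with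
  | zero =>
    have hx : x = 0 := by simpa using hNu
    exact ⟨0, fun N => by rw [hx, qform_zero]⟩
  | succ N ih =>
    refine S.bddAbove_valueIter_of_successor hQ hR hp x (-u N) (ih _ ?_)
    rw [Finset.sum_range_succ, ← sub_eq_iff_eq_add] at hNu
    rw [← hNu, mulVec_add, mulVec_mulVec, ← pow_succ, mulVec_neg, mulVec_neg, mulVec_mulVec,
      sub_eq_add_neg]

/-- Value iteration increases and is bounded, hence converges, and its limit solves the periodic
Riccati equation. -/
theorem exists_isPeriodicRiccatiSolution (hQ : S.Q.PosDef) (hR : S.R.PosDef) {p : ℕ}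
    (hp : 0 < p) (hAB : IsControllablePair S.A S.B) (hA : EigenvalueCondition S.A p) :
    ∃ P, S.IsPeriodicRiccatiSolution p P := by
  have hlim : ∀ x, ∃ q, Tendsto (fun N => qform (S.valueIter p N) x) atTop (𝓝 q) := fun x => by
    obtain ⟨c, hc⟩ := S.bddAbove_valueIter hQ hR hp hAB hA x
    exact ⟨_, tendsto_atTop_ciSup (S.monotone_qform_valueIter hQ hR p x)
      ⟨c, by rintro _ ⟨N, rfl⟩; exact hc N⟩⟩
  choose q hq using hlim
  set P : Matrix (Fin nx) (Fin nx) ℝ := Matrix.of fun i j =>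
    (q (Pi.single i 1 + Pi.single j 1) - q (Pi.single i 1) - q (Pi.single j 1)) / 2 with hP
  have htend : Tendsto (S.valueIter p) atTop (𝓝 P) := by
    refine tendsto_pi_nhds.mpr fun i => tendsto_pi_nhds.mpr fun j => ?_
    simp only [apply_eq_qform (S.valueIter_posSemidef hQ hR p _).isHermitian]
    exact (((hq _).sub (hq _)).sub (hq _)).div_const 2
  have hsymm : P.IsHermitian := by
    ext i j
    simp only [hP, conjTranspose_apply, of_apply, star_trivial,
      add_comm (Pi.single j (1 : ℝ) : Fin nx → ℝ) (Pi.single i 1)]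
    ring
  have hpsd : P.PosSemidef := by
    refine PosSemidef.of_dotProduct_mulVec_nonneg hsymm fun x => ?_
    have hc : Continuous fun M : Matrix (Fin nx) (Fin nx) ℝ => qform M x := by
      unfold qform
      fun_prop
    simpa [qform] using ge_of_tendsto' ((hc.tendsto P).comp htend)
      fun N => qform_nonneg (S.valueIter_posSemidef hQ hR p N) x
  have hfix : P = S.periodMap p P := by
    refine tendsto_nhds_unique ((tendsto_add_atTop_iff_nat 1).mpr htend) ?_
    simp only [valueIter_succ]
    exact (S.continuousAt_periodMap hQ hR p hpsd).tendsto.comp htend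
  exact ⟨P, (S.isPeriodicRiccatiSolution_iff hR hQ hp P).mpr
    ⟨hfix ▸ S.periodMap_posDef hQ hR p hpsd, hfix⟩⟩

end PlantData

/-! ### The rollout cost-to-go along a window -/

namespace PlantData

variable {nx nu ny : ℕ} (S : PlantData nx nu ny) (Pt : Matrix (Fin nx) (Fin nx) ℝ) {h : ℕ}

theorem rolloutP_of_lt (m : Fin h → Bool) {s : ℕ} (hs : s < h) :
    S.rolloutP Pt m s = S.riccatiStep (trig m s) (S.rolloutP Pt m (s + 1)) := by
  rw [rolloutP, if_pos hs]

theorem rolloutP_of_le (m : Fin h → Bool) {s : ℕ} (hs : h ≤ s) : S.rolloutP Pt m s = Pt := by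
  rw [rolloutP, if_neg (not_lt.mpr hs)]

variable {Pt}

theorem rolloutP_posDef (hQ : S.Q.PosDef) (hR : S.R.PosDef) (hPt : Pt.PosDef)
    (m : Fin h → Bool) (s : ℕ) : (S.rolloutP Pt m s).PosDef := by
  obtain ⟨d, hd⟩ : ∃ d, h ≤ s + d := ⟨h, by omega⟩
  induction d generalizing s with
  | zero => rwa [S.rolloutP_of_le Pt m (by omega)]
  | succ d ih =>
    rcases lt_or_ge s h with hs | hs
    · rw [S.rolloutP_of_lt Pt m hs]
      exact S.riccatiStep_posDef hQ hR (ih (s + 1) (by omega)).posSemidef _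
    · rwa [S.rolloutP_of_le Pt m hs]

theorem rolloutP_eq_iterate (m : Fin h → Bool) (s j : ℕ) (hsj : s + j ≤ h)
    (hm : ∀ i < j, trig m (s + i) = false) :
    S.rolloutP Pt m s = (S.riccatiStep false)^[j] (S.rolloutP Pt m (s + j)) := by
  induction j with
  | zero => rfl
  | succ j ih =>
    rw [ih (by omega) fun i hi => hm i (by omega), S.rolloutP_of_lt Pt m (by omega),
      hm j (by omega), Function.iterate_succ_apply, ← add_assoc]

/-- The pattern of the base policy: it acts at the multiples of `p`. -/
def basePattern (p h : ℕ) : Fin h → Bool := fun s => decide (p ∣ (s : ℕ))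

theorem trig_basePattern {p s : ℕ} (hs : s < h) :
    trig (basePattern p h) s = decide (p ∣ s) := by
  simp [trig, hs, basePattern]

/-- Along the base pattern the terminal cost matrix reproduces itself after each period. -/
theorem rolloutP_basePattern (hQ : S.Q.PosDef) (hR : S.R.PosDef) {p : ℕ} (hp : 0 < p)
    (hph : p ∣ h) (hPt : S.IsPeriodicRiccatiSolution p Pt) :
    S.rolloutP Pt (basePattern p h) 0 = Pt := by
  obtain ⟨k, rfl⟩ := hph
  have hfix := ((S.isPeriodicRiccatiSolution_iff hR hQ hp Pt).mp hPt).2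
  have key : ∀ a b, a + b = k → S.rolloutP Pt (basePattern p (p * k)) (p * b) = Pt := by
    intro a
    induction a with
    | zero =>
      intro b hb
      exact S.rolloutP_of_le Pt _ (by rw [← hb, zero_add])
    | succ a ih =>
      intro b hb
      have hle : p * b + p ≤ p * k := by
        rw [← Nat.mul_succ]
        exact Nat.mul_le_mul_left p (by omega)
      rw [S.rolloutP_of_lt Pt _ (by omega), trig_basePattern (by omega),
        S.rolloutP_eq_iterate _ _ (p - 1) (by omega), show p * b + 1 + (p - 1) = p * (b + 1) by
          rw [Nat.mul_succ]; omega, ih (b + 1) (by omega)]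
      · simpa [periodMap] using hfix.symm
      · intro i hi
        rw [trig_basePattern (by omega), decide_eq_false_iff_not, add_assoc,
          Nat.dvd_add_right (Dvd.intro b rfl)]
        exact Nat.not_dvd_of_pos_of_lt (by omega) (by omega)
  exact key k 0 rfl

/-- The stationary initial covariance makes the a posteriori error covariance constant. -/
theorem errCov_eq (hstat : S.Ω₀ = S.Ωw + S.A * S.Ω₀ * S.Aᵀ
      - S.A * S.Ω₀ * S.Cᵀ * (S.C * S.Ω₀ * S.Cᵀ + S.Ωv)⁻¹ * S.C * S.Ω₀ * S.Aᵀ) (k : ℕ) :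
    S.errCov k = S.measUpdate S.Ω₀ := by
  have h : S.priorCov k = S.Ω₀ := by
    induction k with
    | zero => rfl
    | succ k ih =>
      rw [priorCov, ih]
      conv_rhs => rw [hstat]
      simp only [measUpdate, Matrix.mul_sub, Matrix.sub_mul, Matrix.mul_assoc]
      abel
  rw [errCov, h]

/-- Since all lookahead costs differ from their quadratic part by constants, the selected pattern
has quadratic cost at most that of the base policy, up to a constant. -/
theorem exists_quadForm_le_of_rolloutCost_le (hQ : S.Q.PosDef) (hR : S.R.PosDef) {p : ℕ}
    (hp : 0 < p) (hph : p ∣ h) (hPt : S.IsPeriodicRiccatiSolution p Pt) (θ : ℝ)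
    (hstat : S.Ω₀ = S.Ωw + S.A * S.Ω₀ * S.Aᵀ
      - S.A * S.Ω₀ * S.Cᵀ * (S.C * S.Ω₀ * S.Cᵀ + S.Ωv)⁻¹ * S.C * S.Ω₀ * S.Aᵀ) :
    ∃ K : ℝ, 0 ≤ K ∧ ∀ (m : Fin h → Bool) (k : ℕ) (z : Vec nx),
      (∀ m' : Fin h → Bool, S.rolloutCost Pt θ m k z ≤ S.rolloutCost Pt θ m' k z) →
      quadForm (S.rolloutP Pt m 0) z ≤ quadForm Pt z + K := by
  let κ : (Fin h → Bool) → ℝ := fun m => S.rolloutCost Pt θ m 0 0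
  have hκ : ∀ m k z, S.rolloutCost Pt θ m k z = quadForm (S.rolloutP Pt m 0) z + κ m := by
    intro m k z
    have h0 : quadForm (S.rolloutP Pt m 0) 0 = 0 := by simp [quadForm]
    simp only [κ, rolloutCost, rolloutBeta, S.errCov_eq hstat, h0]
    ring
  refine ⟨|κ (basePattern p h)| + ∑ m, |κ m|, by positivity, fun m k z hm => ?_⟩
  have h1 := hm (basePattern p h)
  rw [hκ, hκ, S.rolloutP_basePattern hQ hR hp hph hPt] at h1
  have h2 : |κ m| ≤ ∑ m, |κ m| :=
    Finset.single_le_sum (f := fun m => |κ m|) (fun _ _ => abs_nonneg _) (Finset.mem_univ m)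
  linarith [le_abs_self (κ (basePattern p h)), neg_abs_le (κ m)]

theorem exists_quadForm_rolloutP_le (Pt : Matrix (Fin nx) (Fin nx) ℝ) (h : ℕ) :
    ∃ c : ℝ, 0 < c ∧ ∀ (m : Fin h → Bool) (s : ℕ) (z : Vec nx),
      quadForm (S.rolloutP Pt m s) z ≤ c * ‖z‖ ^ 2 := by
  choose c hc0 hc using fun i : (Fin h → Bool) × ℕ => exists_quadForm_le (S.rolloutP Pt i.1 i.2)
  refine ⟨∑ m, ∑ s ∈ Finset.range (h + 1), c (m, s), ?_, fun m s z => ?_⟩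
  · exact Finset.sum_pos (fun m _ => Finset.sum_pos (fun s _ => hc0 _) (by simp)) (by simp)
  · have hmin : S.rolloutP Pt m s = S.rolloutP Pt m (min s h) := by
      rcases le_total s h with hs | hs
      · rw [min_eq_left hs]
      · rw [min_eq_right hs, S.rolloutP_of_le Pt m hs, S.rolloutP_of_le Pt m le_rfl]
    rw [hmin]
    refine (hc (m, min s h) z).trans (mul_le_mul_of_nonneg_right ?_ (by positivity))
    refine (Finset.single_le_sum (f := fun s => c (m, s)) (fun _ _ => (hc0 _).le)
      (Finset.mem_range.mpr (Nat.lt_succ_of_le (min_le_right s h)))).trans ?_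
    exact Finset.single_le_sum (f := fun m => ∑ s ∈ Finset.range (h + 1), c (m, s))
      (fun _ _ => Finset.sum_nonneg fun _ _ => (hc0 _).le) (Finset.mem_univ m)

theorem exists_le_quadForm_rolloutP (hQ : S.Q.PosDef) (hR : S.R.PosDef) (hPt : Pt.PosDef) :
    ∃ c : ℝ, 0 < c ∧ (∀ z : Vec nx, c * ‖z‖ ^ 2 ≤ quadForm S.Q z) ∧
      ∀ (m : Fin h → Bool) (s : ℕ) (z : Vec nx),
        c * ‖z‖ ^ 2 ≤ quadForm (S.rolloutP Pt m s) z := by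
  obtain ⟨c₁, h₁, hc₁⟩ := exists_le_quadForm hQ
  obtain ⟨c₂, h₂, hc₂⟩ := exists_le_quadForm hPt
  have hle₁ : ∀ z : Vec nx, min c₁ c₂ * ‖z‖ ^ 2 ≤ c₁ * ‖z‖ ^ 2 := fun z => by
    gcongr
    exact min_le_left _ _
  have hle₂ : ∀ z : Vec nx, min c₁ c₂ * ‖z‖ ^ 2 ≤ c₂ * ‖z‖ ^ 2 := fun z => by
    gcongr
    exact min_le_right _ _
  refine ⟨min c₁ c₂, lt_min h₁ h₂, fun z => (hle₁ z).trans (hc₁ z), fun m s z => ?_⟩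
  rcases lt_or_ge s h with hs | hs
  · rw [S.rolloutP_of_lt Pt m hs]
    exact ((hle₁ z).trans (hc₁ z)).trans (S.qform_Q_le_riccatiStep hR
      (S.rolloutP_posDef hQ hR hPt m (s + 1)).posSemidef _ _)
  · rw [S.rolloutP_of_le Pt m hs]
    exact (hle₂ z).trans (hc₂ z)

/-- One step of the closed loop with an additive disturbance `ξ`: up to a factor `1 + η`, the
cost-to-go decreases by the stage cost, at the price of a multiple of `‖ξ‖ ^ 2`. -/
theorem quadForm_rolloutP_succ_le (hQ : S.Q.PosDef) (hR : S.R.PosDef) (hPt : Pt.PosDef)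
    (m : Fin h → Bool) {s : ℕ} (hs : s < h) {η : ℝ} (hη : 0 < η) {a a' ξ : Vec nx}
    (ha : a' = S.A.toEuclideanLin a + S.B.toEuclideanLin
      (if m ⟨s, hs⟩ then (S.rolloutF Pt m s).toEuclideanLin a else 0) + ξ) :
    quadForm (S.rolloutP Pt m (s + 1)) a' ≤
      (1 + η) * (quadForm (S.rolloutP Pt m s) a - quadForm S.Q a)
        + (1 + η⁻¹) * quadForm (S.rolloutP Pt m (s + 1)) ξ := by
  have hP := (S.rolloutP_posDef hQ hR hPt m (s + 1)).posSemidef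
  obtain ⟨u, hu⟩ : ∃ u : Fin nu → ℝ, u =
    (if m ⟨s, hs⟩ then (S.rolloutF Pt m s).toEuclideanLin a else 0 : Vec nu).ofLp := ⟨_, rfl⟩
  have ha' : a'.ofLp = (S.A *ᵥ a.ofLp + S.B *ᵥ u) + ξ.ofLp := by
    rw [ha, hu]
    simp
  have hval : qform (S.rolloutP Pt m s) a.ofLp = qform S.Q a.ofLp + qform S.R u +
      qform (S.rolloutP Pt m (s + 1)) (S.A *ᵥ a.ofLp + S.B *ᵥ u) := by
    have htrig : trig m s = m ⟨s, hs⟩ := by simp [trig, hs]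
    rw [S.rolloutP_of_lt Pt m hs, htrig]
    cases hb : m ⟨s, hs⟩
    · have : u = 0 := by simp [hu, hb]
      simp [this, qform_riccatiStep_false, qform_zero]
    · refine S.qform_riccatiStep_true_eq hR hP _ ?_
      simp [hu, hb, rolloutF, Matrix.mul_assoc, neg_mulVec]
  simp only [quadForm_eq_qform, ha', hval]
  refine (qform_add_le hP hη _ _).trans ?_
  gcongr
  linarith [qform_nonneg hR.posSemidef u]

end PlantData

/-- A discrete Grönwall bound in which a gain `g` is collected at the initial step. -/
theorem le_pow_mul_of_step_le {h : ℕ} {D n : ℕ → ℝ} {b g : ℝ} (hb : 1 ≤ b) (hn : ∀ s, 0 ≤ n s)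
    (h0 : 0 < h → D 1 ≤ b * (D 0 - g) + n 0) (hD : ∀ s < h, D (s + 1) ≤ b * D s + n s) (s : ℕ)
    (hs : s < h) : D (s + 1) ≤ b ^ (s + 1) * (D 0 - g + ∑ j ∈ Finset.range (s + 1), n j) := by
  have hbn : ∀ s, n s ≤ b ^ (s + 1) * n s := fun s =>
    le_mul_of_one_le_left (hn s) (one_le_pow₀ hb)
  induction s with
  | zero =>
    have := hbn 0
    simp only [zero_add, pow_one, Finset.sum_range_one, mul_add] at this ⊢
    linarith [h0 hs]
  | succ s ih =>
    have h1 := mul_le_mul_of_nonneg_left (ih (by omega)) (zero_le_one.trans hb)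
    rw [Finset.sum_range_succ, ← add_assoc, mul_add, pow_succ' b (s + 1), mul_assoc]
    have h2 := hbn (s + 1)
    rw [pow_succ' b (s + 1)] at h2
    linarith [hD (s + 1) hs]

namespace PlantData

variable {nx nu ny : ℕ} (S : PlantData nx nu ny) {Pt : Matrix (Fin nx) (Fin nx) ℝ} {h : ℕ}

/-- Over a window whose pattern costs at most `K` more than the base policy, the Lyapunov function
`quadForm Pt` contracts, up to the disturbances; inside the window the state stays comparable with
its initial value. -/
theorem exists_window_contraction (hh : 0 < h) (hQ : S.Q.PosDef) (hR : S.R.PosDef)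
    (hPt : Pt.PosDef) {K : ℝ} (hK : 0 ≤ K) :
    ∃ r c : ℝ, 0 ≤ r ∧ r < 1 ∧ 0 ≤ c ∧ ∀ (m : Fin h → Bool) (a ξ : ℕ → Vec nx),
      quadForm (S.rolloutP Pt m 0) (a 0) ≤ quadForm Pt (a 0) + K →
      (∀ (s : ℕ) (hs : s < h), a (s + 1) = S.A.toEuclideanLin (a s) + S.B.toEuclideanLin
        (if m ⟨s, hs⟩ then (S.rolloutF Pt m s).toEuclideanLin (a s) else 0) + ξ s) →
      quadForm Pt (a h) ≤ r * quadForm Pt (a 0) + c * (1 + ∑ s ∈ Finset.range h, ‖ξ s‖ ^ 2) ∧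
      ∀ s ≤ h, ‖a s‖ ^ 2 ≤ c * (quadForm Pt (a 0) + (1 + ∑ s ∈ Finset.range h, ‖ξ s‖ ^ 2)) := by
  obtain ⟨c₁, hc₁, hup⟩ := S.exists_quadForm_rolloutP_le Pt h
  obtain ⟨c₂, hc₂, hlowQ, hlow⟩ := S.exists_le_quadForm_rolloutP (h := h) hQ hR hPt
  obtain ⟨c₃, hc₃, hupt⟩ := exists_quadForm_le Pt
  -- `quadForm S.Q ≥ ε • quadForm Pt`; adding `c₂` to the denominator ensures `ε < 1`
  obtain ⟨ε, hε0, hε1, hε⟩ : ∃ ε : ℝ, 0 < ε ∧ ε < 1 ∧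
      ∀ z : Vec nx, ε * quadForm Pt z ≤ quadForm S.Q z := by
    refine ⟨c₂ / (c₃ + c₂), by positivity, by rw [div_lt_one (by positivity)]; linarith,
      fun z => ?_⟩
    refine le_trans ?_ (hlowQ z)
    rw [div_mul_eq_mul_div, div_le_iff₀ (by positivity), mul_assoc]
    gcongr
    nlinarith [hupt z, mul_nonneg hc₂.le (sq_nonneg ‖z‖)]
  obtain ⟨η, hη0, hη⟩ : ∃ η : ℝ, 0 < η ∧ (1 + η) ^ h * (1 - ε) < 1 := by
    have hcont : ContinuousAt (fun η : ℝ => (1 + η) ^ h * (1 - ε)) 0 := by fun_prop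
    have hev : ∀ᶠ η in 𝓝 (0 : ℝ), (1 + η) ^ h * (1 - ε) < 1 :=
      hcont.eventually_lt continuousAt_const (by simpa using hε0)
    obtain ⟨η, h1, h2⟩ := ((hev.filter_mono nhdsWithin_le_nhds).and
      (self_mem_nhdsWithin (a := (0 : ℝ)) (s := Set.Ioi 0))).exists
    exact ⟨η, h2, h1⟩
  set b := 1 + η with hb
  have hb1 : 1 ≤ b := by linarith
  have hbpos : 0 < b := by linarith
  set c₄ := (1 + η⁻¹) * c₁ with hc₄
  have hc₄0 : 0 < c₄ := by positivity
  have hPtn : ∀ z : Vec nx, 0 ≤ quadForm Pt z := fun z => qform_nonneg hPt.posSemidef _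
  set C := b ^ h * (1 + K + c₄) with hC
  have hC0 : 0 < C := by positivity
  have hbh : 1 ≤ b ^ h := one_le_pow₀ hb1
  refine ⟨b ^ h * (1 - ε), C + C / c₂, mul_nonneg (by positivity) (by linarith), hη,
    by positivity, fun m a ξ hsel hstep => ?_⟩
  set V := quadForm Pt (a 0) with hV
  set N := ∑ s ∈ Finset.range h, ‖ξ s‖ ^ 2 with hN
  have hN0 : 0 ≤ N := Finset.sum_nonneg fun _ _ => by positivity
  have hV0 : 0 ≤ V := hPtn _
  let D : ℕ → ℝ := fun s => quadForm (S.rolloutP Pt m s) (a s)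
  have hD : ∀ s < h, D (s + 1) ≤ b * (D s - quadForm S.Q (a s)) + c₄ * ‖ξ s‖ ^ 2 := by
    intro s hs
    refine (S.quadForm_rolloutP_succ_le hQ hR hPt m hs hη0 (hstep s hs)).trans ?_
    rw [hc₄, mul_assoc]
    gcongr
    exact hup m (s + 1) (ξ s)
  have hQn : ∀ z : Vec nx, 0 ≤ quadForm S.Q z := fun z => qform_nonneg hQ.posSemidef _
  have hgron := le_pow_mul_of_step_le (h := h) (D := D) (n := fun s => c₄ * ‖ξ s‖ ^ 2)
    (g := quadForm S.Q (a 0)) hb1 (fun s => by positivity) (hD 0) fun s hs =>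
      (hD s hs).trans (by
        gcongr
        linarith [hQn (a s)])
  have hCK : K + c₄ * N ≤ (1 + K + c₄) * (1 + N) := by nlinarith [mul_nonneg hK hN0]
  constructor
  · have h1 := hgron (h - 1) (by omega)
    rw [Nat.sub_add_cancel hh, ← Finset.mul_sum] at h1
    have hDh : D h = quadForm Pt (a h) := by simp only [D, S.rolloutP_of_le Pt m le_rfl]
    rw [← hDh]
    have h2 : D 0 - quadForm S.Q (a 0) + c₄ * N ≤ (1 - ε) * V + (1 + K + c₄) * (1 + N) := by
      have : D 0 ≤ V + K := hsel
      linarith [hε (a 0)]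
    have h3 : 0 ≤ C / c₂ * (1 + N) := by positivity
    calc D h ≤ b ^ h * ((1 - ε) * V + (1 + K + c₄) * (1 + N)) :=
          h1.trans (mul_le_mul_of_nonneg_left h2 (by positivity))
      _ = b ^ h * (1 - ε) * V + C * (1 + N) := by rw [hC]; ring
      _ ≤ _ := by rw [add_mul C]; linarith
  · intro s hs
    have hDs : D s ≤ C * (V + (1 + N)) := by
      have hV1 : V + K + c₄ * N ≤ (1 + K + c₄) * (V + (1 + N)) := by
        nlinarith [mul_nonneg hK hV0, mul_nonneg hc₄0.le hV0]
      have hbase : D 0 ≤ V + K := hsel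
      rcases Nat.eq_zero_or_pos s with rfl | hs0
      · rw [hC, mul_assoc]
        refine le_trans ?_ (le_mul_of_one_le_left (by positivity) hbh)
        linarith [mul_nonneg hc₄0.le hN0]
      · have h1 := hgron (s - 1) (by omega)
        rw [Nat.sub_add_cancel hs0, ← Finset.mul_sum] at h1
        have hNs : ∑ j ∈ Finset.range s, ‖ξ j‖ ^ 2 ≤ N :=
          Finset.sum_le_sum_of_subset_of_nonneg (Finset.range_mono hs) fun _ _ _ => by positivity
        rw [hC, mul_assoc]
        refine h1.trans (mul_le_mul (pow_le_pow_right₀ hb1 hs) ?_ ?_ (by positivity))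
        · linarith [hQn (a 0), mul_le_mul_of_nonneg_left hNs hc₄0.le]
        · have : quadForm S.Q (a 0) ≤ D 0 := by
            simp only [D, S.rolloutP_of_lt Pt m hh]
            exact S.qform_Q_le_riccatiStep hR
              (S.rolloutP_posDef hQ hR hPt m 1).posSemidef _ _
          have h5 : 0 ≤ c₄ * ∑ j ∈ Finset.range s, ‖ξ j‖ ^ 2 := by positivity
          linarith
    have h4 : ‖a s‖ ^ 2 ≤ C / c₂ * (V + (1 + N)) := by
      rw [div_mul_eq_mul_div, le_div_iff₀ hc₂, mul_comm]
      exact (hlow m s (a s)).trans hDs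
    have h5 : 0 ≤ C * (V + (1 + N)) := by positivity
    rw [add_mul]
    linarith

end PlantData

/-! ### Second moments -/

section SecondMoments

variable {Ω : Type*} [MeasurableSpace Ω] {μ : Measure Ω} {E F : Type*} [NormedAddCommGroup E]
  [NormedAddCommGroup F]

theorem lintegral_enorm_sq_eq (f : Ω → E) : ∫⁻ ω, ‖f ω‖ₑ ^ 2 ∂μ = eLpNorm f 2 μ ^ 2 := by
  have := eLpNorm_nnreal_pow_eq_lintegral (f := f) (μ := μ) (p := 2) two_ne_zero
  simpa using this.symm

theorem MeasureTheory.MemLp.lintegral_enorm_sq {f : Ω → E} (hf : MemLp f 2 μ) :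
    ∫⁻ ω, ‖f ω‖ₑ ^ 2 ∂μ = ENNReal.ofReal (∫ ω, ‖f ω‖ ^ 2 ∂μ) := by
  rw [ofReal_integral_eq_lintegral_ofReal (hf.integrable_norm_pow two_ne_zero)
    (ae_of_all _ fun _ => by positivity)]
  refine lintegral_congr fun ω => ?_
  rw [ENNReal.ofReal_pow (norm_nonneg _), ofReal_norm]

theorem integral_norm_sq_le_of_eLpNorm_le {f : Ω → E} {g : Ω → F} (hf : MemLp f 2 μ)
    (hg : MemLp g 2 μ) (h : eLpNorm f 2 μ ≤ eLpNorm g 2 μ) :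
    ∫ ω, ‖f ω‖ ^ 2 ∂μ ≤ ∫ ω, ‖g ω‖ ^ 2 ∂μ := by
  rw [← ENNReal.ofReal_le_ofReal_iff (integral_nonneg fun _ => by positivity),
    ← hf.lintegral_enorm_sq, ← hg.lintegral_enorm_sq, lintegral_enorm_sq_eq,
    lintegral_enorm_sq_eq]
  gcongr

theorem integral_norm_sub_sq_le {f g : Ω → E} (hf : MemLp f 2 μ) (hg : MemLp g 2 μ) :
    ∫ ω, ‖f ω - g ω‖ ^ 2 ∂μ ≤ 2 * ∫ ω, ‖f ω‖ ^ 2 ∂μ + 2 * ∫ ω, ‖g ω‖ ^ 2 ∂μ := by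
  have hf' := hf.integrable_norm_pow two_ne_zero
  have hg' := hg.integrable_norm_pow two_ne_zero
  rw [← integral_const_mul, ← integral_const_mul,
    ← integral_add (hf'.const_mul 2) (hg'.const_mul 2)]
  refine integral_mono ((hf.sub hg).integrable_norm_pow two_ne_zero)
    ((hf'.const_mul 2).add (hg'.const_mul 2)) fun ω => ?_
  have h1 : ‖f ω - g ω‖ ^ 2 ≤ (‖f ω‖ + ‖g ω‖) ^ 2 := by
    gcongr
    exact norm_sub_le _ _
  show ‖f ω - g ω‖ ^ 2 ≤ 2 * ‖f ω‖ ^ 2 + 2 * ‖g ω‖ ^ 2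
  linarith [add_sq_le (a := ‖f ω‖) (b := ‖g ω‖)]

theorem integral_norm_add_sq_le {f g : Ω → E} (hf : MemLp f 2 μ) (hg : MemLp g 2 μ) :
    ∫ ω, ‖f ω + g ω‖ ^ 2 ∂μ ≤ 2 * ∫ ω, ‖f ω‖ ^ 2 ∂μ + 2 * ∫ ω, ‖g ω‖ ^ 2 ∂μ := by
  simpa using integral_norm_sub_sq_le hf hg.neg

theorem integral_norm_clm_sq_le [NormedSpace ℝ E] [NormedSpace ℝ F] (L : E →L[ℝ] F) {f : Ω → E}
    (hf : MemLp f 2 μ) :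
    ∫ ω, ‖L (f ω)‖ ^ 2 ∂μ ≤ ‖L‖ ^ 2 * ∫ ω, ‖f ω‖ ^ 2 ∂μ := by
  rw [← integral_const_mul]
  refine integral_mono ((L.comp_memLp' hf).integrable_norm_pow two_ne_zero)
    ((hf.integrable_norm_pow two_ne_zero).const_mul _) fun ω => ?_
  show ‖L (f ω)‖ ^ 2 ≤ ‖L‖ ^ 2 * ‖f ω‖ ^ 2
  rw [← mul_pow]
  gcongr
  exact L.le_opNorm _

end SecondMoments

theorem ProbabilityTheory.HasLaw.memLp_two_multivariateGaussian {Ω : Type*} [MeasurableSpace Ω]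
    {μ : Measure Ω} {n : ℕ} {X : Ω → Vec n} {a : Vec n} {M : Matrix (Fin n) (Fin n) ℝ}
    (hX : HasLaw X (multivariateGaussian a M) μ) : MemLp X 2 μ := by
  have h := IsGaussian.memLp_two_id (μ := multivariateGaussian a M)
  rw [← hX.map_eq] at h
  exact (memLp_map_measure_iff h.1 hX.aemeasurable).mp h

theorem ProbabilityTheory.HasLaw.integral_norm_sq_eq {Ω : Type*} [MeasurableSpace Ω]
    {μ : Measure Ω} {n : ℕ} {X : Ω → Vec n} {ν : Measure (Vec n)} (hX : HasLaw X ν μ) :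
    ∫ ω, ‖X ω‖ ^ 2 ∂μ = ∫ z, ‖z‖ ^ 2 ∂ν :=
  hX.integral_comp (f := fun z => ‖z‖ ^ 2) (by fun_prop)

/-! ### The closed loop -/

theorem exists_leftInverse_of_rank_eq {m n : ℕ} {C : Matrix (Fin m) (Fin n) ℝ}
    (hC : C.rank = n) : ∃ G : Vec m →L[ℝ] Vec n, ∀ z, G (C.toEuclideanLin z) = z := by
  have hinj : LinearMap.ker C.toEuclideanLin = ⊥ := by
    have h1 : LinearMap.ker C.mulVecLin = ⊥ := by
      rw [← Submodule.finrank_eq_zero (R := ℝ)]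
      have := C.mulVecLin.finrank_range_add_finrank_ker
      rw [Module.finrank_fin_fun] at this
      have hr : Module.finrank ℝ (LinearMap.range C.mulVecLin) = n := hC
      omega
    rw [LinearMap.ker_eq_bot']
    intro z hz
    have : C.mulVecLin z.ofLp = 0 := by
      simpa using congrArg WithLp.ofLp hz
    have := LinearMap.ker_eq_bot'.mp h1 _ this
    ext i
    simpa using congrFun this i
  obtain ⟨G, hG⟩ := C.toEuclideanLin.exists_leftInverse_of_injective hinj
  exact ⟨G.toContinuousLinearMap, fun z => LinearMap.congr_fun hG z⟩

namespace IsRolloutLoop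

variable {Ω : Type*} [MeasurableSpace Ω] {μ : Measure Ω} {nx nu ny : ℕ}
  {S : PlantData nx nu ny} {Pt : Matrix (Fin nx) (Fin nx) ℝ} {θ : ℝ} {h : ℕ}
  {x₀ : Ω → Vec nx} {w : ℕ → Ω → Vec nx} {v : ℕ → Ω → Vec ny}
  {x : ℕ → Ω → Vec nx} {y : ℕ → Ω → Vec ny} {xhat : ℕ → Ω → Vec nx}
  {u : ℕ → Ω → Vec nu} {δ : ℕ → Ω → Bool} {φ : ℕ → Ω → Fin h → Bool}

/-- The control law at an arbitrary time, as position `k % h` in window `k / h`. -/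
theorem control_eq (hL : IsRolloutLoop μ S Pt θ h x₀ w v x y xhat u δ φ) (hh : 0 < h) (k : ℕ)
    (ω : Ω) : u k ω = if φ (k / h) ω ⟨k % h, Nat.mod_lt k hh⟩ then
      (S.rolloutF Pt (φ (k / h) ω) (k % h)).toEuclideanLin (xhat k ω) else 0 := by
  have := hL.control (k / h) ⟨k % h, Nat.mod_lt k hh⟩ ω
  simpa only [Nat.div_add_mod'] using this

theorem trigger_eq (hL : IsRolloutLoop μ S Pt θ h x₀ w v x y xhat u δ φ) (hh : 0 < h) (k : ℕ)
    (ω : Ω) : δ k ω = φ (k / h) ω ⟨k % h, Nat.mod_lt k hh⟩ := by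
  have := hL.trigger (k / h) ⟨k % h, Nat.mod_lt k hh⟩ ω
  simpa only [Nat.div_add_mod'] using this

theorem infoSigma_le_of_measurable (hy : ∀ i, Measurable (v i))
    (hL : IsRolloutLoop μ S Pt θ h x₀ w v x y xhat u δ φ) {k : ℕ}
    (hx : ∀ i ≤ k, Measurable (x i)) (hu : ∀ j < k, Measurable (u j) ∧ Measurable (δ j)) :
    infoSigma y u δ k ≤ ‹MeasurableSpace Ω› := by
  refine sup_le (iSup_le fun i => ?_) (iSup_le fun j => sup_le ?_ ?_)
  · have hyi : y i = fun ω => S.C.toEuclideanLin (x i ω) + v i ω := funext (hL.output i)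
    have hC : Continuous S.C.toEuclideanLin := LinearMap.continuous_of_finiteDimensional _
    rw [hyi]
    exact ((hC.measurable.comp (hx i (Nat.lt_succ_iff.mp i.2))).add (hy i)).comap_le
  · exact (hu j j.2).1.comap_le
  · exact (hu j j.2).2.comap_le

/-- The information at each time is part of the ambient σ-algebra, and the state and the inputs are
random variables. -/
theorem measurable_state_control_trigger (hL : IsRolloutLoop μ S Pt θ h x₀ w v x y xhat u δ φ)
    (hN : IsPlantNoise μ S x₀ w v) (hh : 0 < h) (k : ℕ) :
    (∀ i ≤ k, Measurable (x i)) ∧ ∀ j < k, Measurable (u j) ∧ Measurable (δ j) := by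
  induction k with
  | zero =>
    refine ⟨fun i hi => ?_, fun j hj => absurd hj (Nat.not_lt_zero j)⟩
    rw [Nat.le_zero.mp hi, hL.init]
    exact hN.measurable_init
  | succ k ih =>
    obtain ⟨hx, hu⟩ := ih
    have hle := infoSigma_le_of_measurable hN.measurable_v hL hx hu
    have hxhat : Measurable (xhat k) := (hL.estimate_meas k).mono hle le_rfl
    have hlk : k / h * h ≤ k := Nat.div_mul_le_self k h
    have hφ : Measurable (φ (k / h)) := (hL.select_meas (k / h)).mono
      (infoSigma_le_of_measurable hN.measurable_v hL (fun i hi => hx i (hi.trans hlk))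
        fun j hj => hu j (hj.trans_le hlk)) le_rfl
    have huk : Measurable (u k) := by
      have hpair : Measurable fun q : (Fin h → Bool) × Vec nx =>
          (if q.1 ⟨k % h, Nat.mod_lt k hh⟩ then
            (S.rolloutF Pt q.1 (k % h)).toEuclideanLin q.2 else 0 : Vec nu) := by
        refine measurable_from_prod_countable_right fun m => ?_
        by_cases hm : m ⟨k % h, Nat.mod_lt k hh⟩
        · simp only [hm, if_true]
          exact (LinearMap.continuous_of_finiteDimensional _).measurable
        · simp only [hm, Bool.false_eq_true, if_false]
          exact measurable_const
      have := hpair.comp (hφ.prodMk hxhat)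
      convert this using 1
      exact funext (hL.control_eq hh k)
    have hδk : Measurable (δ k) := by
      rw [show δ k = fun ω => φ (k / h) ω ⟨k % h, Nat.mod_lt k hh⟩ from
        funext (hL.trigger_eq hh k)]
      exact (measurable_pi_apply _).comp hφ
    have hA : Continuous S.A.toEuclideanLin := LinearMap.continuous_of_finiteDimensional _
    have hB : Continuous S.B.toEuclideanLin := LinearMap.continuous_of_finiteDimensional _
    have hxk : Measurable (x (k + 1)) := by
      rw [show x (k + 1) = _ from funext (hL.state k)]
      exact ((hA.measurable.comp (hx k le_rfl)).add (hB.measurable.comp huk)).add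
        (hN.measurable_w k)
    refine ⟨fun i hi => ?_, fun j hj => ?_⟩
    · rcases Nat.le_succ_iff.mp hi with hi | rfl
      · exact hx i hi
      · exact hxk
    · rcases Nat.lt_succ_iff_lt_or_eq.mp hj with hj | rfl
      · exact hu j hj
      · exact ⟨huk, hδk⟩

theorem infoSigma_le (hL : IsRolloutLoop μ S Pt θ h x₀ w v x y xhat u δ φ)
    (hN : IsPlantNoise μ S x₀ w v) (hh : 0 < h) (k : ℕ) :
    infoSigma y u δ k ≤ ‹MeasurableSpace Ω› :=
  infoSigma_le_of_measurable hN.measurable_v hL (hL.measurable_state_control_trigger hN hh k).1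
    (hL.measurable_state_control_trigger hN hh k).2

theorem measurable_control (hL : IsRolloutLoop μ S Pt θ h x₀ w v x y xhat u δ φ)
    (hN : IsPlantNoise μ S x₀ w v) (hh : 0 < h) (k : ℕ) : Measurable (u k) :=
  ((hL.measurable_state_control_trigger hN hh (k + 1)).2 k (Nat.lt_succ_self k)).1

theorem exists_norm_control_le (hL : IsRolloutLoop μ S Pt θ h x₀ w v x y xhat u δ φ)
    (hh : 0 < h) (k : ℕ) : ∃ c : ℝ, ∀ ω, ‖u k ω‖ ≤ c * ‖xhat k ω‖ := by
  let L (m : Fin h → Bool) : Vec nx →L[ℝ] Vec nu :=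
    (S.rolloutF Pt m (k % h)).toEuclideanLin.toContinuousLinearMap
  refine ⟨∑ m, ‖L m‖, fun ω => ?_⟩
  rw [hL.control_eq hh]
  split_ifs
  · refine ((L (φ (k / h) ω)).le_opNorm (xhat k ω)).trans ?_
    gcongr
    exact Finset.single_le_sum (f := fun m => ‖L m‖) (fun _ _ => norm_nonneg _)
      (Finset.mem_univ _)
  · rw [norm_zero]
    positivity

theorem memLp_estimate_of_state (hL : IsRolloutLoop μ S Pt θ h x₀ w v x y xhat u δ φ) {k : ℕ}
    (hx : MemLp (x k) 2 μ) : MemLp (xhat k) 2 μ :=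
  (memLp_congr_ae (hL.estimate k)).mpr (hx.condExp one_le_two)

theorem memLp_state (hL : IsRolloutLoop μ S Pt θ h x₀ w v x y xhat u δ φ)
    (hN : IsPlantNoise μ S x₀ w v) (hh : 0 < h) (k : ℕ) : MemLp (x k) 2 μ := by
  induction k with
  | zero =>
    rw [hL.init]
    exact hN.law_init.memLp_two_multivariateGaussian
  | succ k ih =>
    have hu : MemLp (u k) 2 μ := by
      obtain ⟨c, hc⟩ := hL.exists_norm_control_le hh k
      exact (hL.memLp_estimate_of_state ih).of_le_mul
        (hL.measurable_control hN hh k).aestronglyMeasurable (ae_of_all _ hc)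
    rw [show x (k + 1) = _ from funext (hL.state k)]
    exact ((S.A.toEuclideanLin.toContinuousLinearMap.comp_memLp' ih).add
      (S.B.toEuclideanLin.toContinuousLinearMap.comp_memLp' hu)).add
      (hN.law_w k).memLp_two_multivariateGaussian

theorem memLp_estimate (hL : IsRolloutLoop μ S Pt θ h x₀ w v x y xhat u δ φ)
    (hN : IsPlantNoise μ S x₀ w v) (hh : 0 < h) (k : ℕ) : MemLp (xhat k) 2 μ :=
  hL.memLp_estimate_of_state (hL.memLp_state hN hh k)

/-- The estimation error is bounded in mean square. Since `C` has a left inverse `G`, the state is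
`G y - G v` with `G y` known, so the error is that of estimating `G v` from the information, and
conditional expectation contracts the `L²` norm. -/
theorem exists_integral_error_sq_le (hC : S.C.rank = nx) (hh : 0 < h)
    [IsProbabilityMeasure μ] (hL : IsRolloutLoop μ S Pt θ h x₀ w v x y xhat u δ φ)
    (hN : IsPlantNoise μ S x₀ w v) :
    ∃ K : ℝ, ∀ k, ∫ ω, ‖x k ω - xhat k ω‖ ^ 2 ∂μ ≤ K := by
  obtain ⟨G, hG⟩ := exists_leftInverse_of_rank_eq hC
  refine ⟨4 * (‖G‖ ^ 2 * ∫ z, ‖z‖ ^ 2 ∂(multivariateGaussian 0 S.Ωv)), fun k => ?_⟩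
  have hm := hL.infoSigma_le hN hh k
  have hv : MemLp (v k) 2 μ := (hN.law_v k).memLp_two_multivariateGaussian
  have hGv : MemLp (fun ω => G (v k ω)) 2 μ := G.comp_memLp' hv
  have hGy : (fun ω => G (y k ω)) = x k + fun ω => G (v k ω) := by
    ext1 ω
    rw [hL.output, map_add, hG]
    rfl
  have hGy2 : MemLp (fun ω => G (y k ω)) 2 μ := hGy ▸ (hL.memLp_state hN hh k).add hGv
  have hymeas : Measurable[infoSigma y u δ k] (y k) := by
    refine Measurable.mono (comap_measurable (y k)) ?_ le_rfl
    exact le_sup_of_le_left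
      (le_iSup (fun i : Fin (k + 1) => MeasurableSpace.comap (y i) inferInstance) (Fin.last k))
  have hGymeas : StronglyMeasurable[infoSigma y u δ k] (fun ω => G (y k ω)) :=
    (G.continuous.measurable.comp hymeas).stronglyMeasurable
  have hx : x k = (fun ω => G (y k ω)) - fun ω => G (v k ω) := by
    rw [hGy, add_sub_cancel_right]
  have herr : (fun ω => x k ω - xhat k ω) =ᵐ[μ]
      fun ω => (μ[fun ω => G (v k ω) | infoSigma y u δ k]) ω - G (v k ω) := by
    have hsub := condExp_sub (hGy2.integrable one_le_two) (hGv.integrable one_le_two)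
      (infoSigma y u δ k)
    rw [← hx, condExp_of_stronglyMeasurable hm hGymeas (hGy2.integrable one_le_two)] at hsub
    filter_upwards [hL.estimate k, hsub] with ω h1 h2
    rw [h1, h2, congrFun hx ω]
    simp only [Pi.sub_apply]
    abel
  have hcond := hGv.condExp (m := infoSigma y u δ k) one_le_two
  have hcle := integral_norm_sq_le_of_eLpNorm_le hcond hGv
    (eLpNorm_condExp_le_eLpNorm _ one_le_two)
  calc ∫ ω, ‖x k ω - xhat k ω‖ ^ 2 ∂μ
      = ∫ ω, ‖(μ[fun ω => G (v k ω) | infoSigma y u δ k]) ω - G (v k ω)‖ ^ 2 ∂μ :=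
        integral_congr_ae (herr.mono fun ω hω => by simp only [hω])
    _ ≤ 4 * ∫ ω, ‖G (v k ω)‖ ^ 2 ∂μ := by
        linarith [integral_norm_sub_sq_le hcond hGv]
    _ ≤ _ := by
        rw [← (hN.law_v k).integral_norm_sq_eq]
        gcongr
        exact integral_norm_clm_sq_le G hv

/-- The estimate follows the plant dynamics up to a disturbance that is bounded in mean square. -/
theorem exists_integral_innovation_sq_le (hC : S.C.rank = nx) (hh : 0 < h)
    [IsProbabilityMeasure μ] (hL : IsRolloutLoop μ S Pt θ h x₀ w v x y xhat u δ φ)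
    (hN : IsPlantNoise μ S x₀ w v) :
    ∃ (ξ : ℕ → Ω → Vec nx) (K : ℝ), (∀ k, MemLp (ξ k) 2 μ) ∧
      (∀ k, ∫ ω, ‖ξ k ω‖ ^ 2 ∂μ ≤ K) ∧ ∀ k ω, xhat (k + 1) ω =
        S.A.toEuclideanLin (xhat k ω) + S.B.toEuclideanLin (u k ω) + ξ k ω := by
  obtain ⟨K, hK⟩ := hL.exists_integral_error_sq_le hC hh hN
  let LA := S.A.toEuclideanLin.toContinuousLinearMap
  have he : ∀ k, MemLp (fun ω => x k ω - xhat k ω) 2 μ := fun k =>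
    (hL.memLp_state hN hh k).sub (hL.memLp_estimate hN hh k)
  have hw : ∀ k, MemLp (w k) 2 μ := fun k => (hN.law_w k).memLp_two_multivariateGaussian
  have hsum : ∀ k, MemLp (fun ω => LA (x k ω - xhat k ω) + w k ω) 2 μ := fun k =>
    (LA.comp_memLp' (he k)).add (hw k)
  refine ⟨fun k ω => (LA (x k ω - xhat k ω) + w k ω) - (x (k + 1) ω - xhat (k + 1) ω),
    2 * (2 * (‖LA‖ ^ 2 * K) + 2 * ∫ z, ‖z‖ ^ 2 ∂(multivariateGaussian 0 S.Ωw)) + 2 * K,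
    fun k => (hsum k).sub (he (k + 1)), fun k => ?_, fun k ω => ?_⟩
  · refine (integral_norm_sub_sq_le (hsum k) (he (k + 1))).trans ?_
    have h1 := integral_norm_add_sq_le (LA.comp_memLp' (he k)) (hw k)
    have h2 := integral_norm_clm_sq_le LA (he k)
    rw [(hN.law_w k).integral_norm_sq_eq] at h1
    have h3 := mul_le_mul_of_nonneg_left (hK k) (sq_nonneg ‖LA‖)
    have h4 := hK (k + 1)
    simp only [Function.comp_apply] at h1
    linarith
  · have hLA : ∀ z, LA z = S.A.toEuclideanLin z := fun _ => rfl
    simp only [hLA, hL.state k ω, map_sub]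
    abel

/-- Mean-square stability of the estimate: the expected Lyapunov function at the beginnings of the
windows obeys an affine contraction. -/
theorem exists_integral_estimate_sq_le (hh : 0 < h) {p : ℕ} (hp : 0 < p) (hph : p ∣ h)
    (hR : S.R.PosDef) (hQ : S.Q.PosDef) (hC : S.C.rank = nx)
    (hstat : S.Ω₀ = S.Ωw + S.A * S.Ω₀ * S.Aᵀ
      - S.A * S.Ω₀ * S.Cᵀ * (S.C * S.Ω₀ * S.Cᵀ + S.Ωv)⁻¹ * S.C * S.Ω₀ * S.Aᵀ)
    (hPt : S.IsPeriodicRiccatiSolution p Pt) [IsProbabilityMeasure μ]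
    (hL : IsRolloutLoop μ S Pt θ h x₀ w v x y xhat u δ φ) (hN : IsPlantNoise μ S x₀ w v) :
    ∃ K : ℝ, ∀ k, ∫ ω, ‖xhat k ω‖ ^ 2 ∂μ ≤ K := by
  obtain ⟨ξ, X, hξ2, hξX, hξ⟩ := hL.exists_integral_innovation_sq_le hC hh hN
  obtain ⟨K, hK0, hK⟩ := S.exists_quadForm_le_of_rolloutCost_le hQ hR hp hph hPt θ hstat
  obtain ⟨r, c, hr0, hr1, hc0, hwin⟩ := S.exists_window_contraction hh hQ hR hPt.1 hK0
  have hpt : ∀ l ω, _ := fun l ω => hwin (φ l ω) (fun s => xhat (l * h + s) ω)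
    (fun s => ξ (l * h + s) ω) (hK _ _ _ (hL.select l ω)) fun s hs => by
      rw [← add_assoc, hξ, hL.control l ⟨s, hs⟩ ω]
  obtain ⟨c₁, hc₁, hup⟩ := exists_quadForm_le Pt
  have hV0 : ∀ z : Vec nx, 0 ≤ quadForm Pt z := fun z => qform_nonneg hPt.1.posSemidef _
  have hVint : ∀ k, Integrable (fun ω => quadForm Pt (xhat k ω)) μ := fun k => by
    have h2 := hL.memLp_estimate hN hh k
    refine ((h2.integrable_norm_pow two_ne_zero).const_mul c₁).mono'
      ((continuous_quadForm Pt).comp_aestronglyMeasurable h2.1) (ae_of_all _ fun ω => ?_)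
    rw [Real.norm_of_nonneg (hV0 _)]
    exact hup _
  set N : ℕ → Ω → ℝ := fun l ω => 1 + ∑ s ∈ Finset.range h, ‖ξ (l * h + s) ω‖ ^ 2 with hNdef
  have hξint : ∀ k, Integrable (fun ω => ‖ξ k ω‖ ^ 2) μ := fun k =>
    (hξ2 k).integrable_norm_pow two_ne_zero
  have hNint : ∀ l, Integrable (N l) μ := fun l =>
    (integrable_const 1).add (integrable_finsetSum _ fun s _ => hξint _)
  have hNle : ∀ l, ∫ ω, N l ω ∂μ ≤ 1 + h * X := by
    intro l
    simp only [hNdef]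
    rw [integral_add (integrable_const 1) (integrable_finsetSum _ fun s _ => hξint _),
      integral_finsetSum _ fun s _ => hξint _]
    have := Finset.sum_le_sum fun s (_ : s ∈ Finset.range h) => hξX (l * h + s)
    simpa using this
  have hX0 : 0 ≤ X := (integral_nonneg fun _ => by positivity).trans (hξX 0)
  set Y := 1 + h * X with hY
  have hY0 : 0 ≤ Y := by positivity
  set d : ℕ → ℝ := fun l => ∫ ω, quadForm Pt (xhat (l * h) ω) ∂μ with hd
  have hd0 : ∀ l, 0 ≤ d l := fun l => integral_nonneg fun _ => hV0 _
  have hrec : ∀ l, d (l + 1) ≤ r * d l + c * Y := by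
    intro l
    have h1 : d (l + 1) ≤ ∫ ω, (r * quadForm Pt (xhat (l * h) ω) + c * N l ω) ∂μ := by
      refine integral_mono (hVint _) (((hVint _).const_mul r).add ((hNint l).const_mul c))
        fun ω => ?_
      have := (hpt l ω).1
      rw [← Nat.succ_mul] at this
      exact this
    rw [integral_add ((hVint _).const_mul r) ((hNint l).const_mul c), integral_const_mul,
      integral_const_mul] at h1
    exact h1.trans (by gcongr; exact hNle l)
  have hbd : ∀ l, d l ≤ d 0 + c * Y / (1 - r) := by
    have hpos : 0 < 1 - r := by linarith
    have hcY : 0 ≤ c * Y := mul_nonneg hc0 hY0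
    intro l
    induction l with
    | zero =>
      have : 0 ≤ c * Y / (1 - r) := by positivity
      linarith
    | succ l ih =>
      have h1 := mul_le_mul_of_nonneg_left ih hr0
      have h2 : r * (c * Y / (1 - r)) + c * Y = c * Y / (1 - r) := by
        field_simp
        ring
      have h3 : r * d 0 ≤ d 0 := mul_le_of_le_one_left (hd0 0) hr1.le
      linarith [hrec l]
  refine ⟨c * (d 0 + c * Y / (1 - r) + Y), fun k => ?_⟩
  set l := k / h with hl
  have hk : l * h + k % h = k := Nat.div_add_mod' k h
  have h1 : ∫ ω, ‖xhat k ω‖ ^ 2 ∂μ ≤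
      ∫ ω, c * (quadForm Pt (xhat (l * h) ω) + N l ω) ∂μ := by
    refine integral_mono ((hL.memLp_estimate hN hh k).integrable_norm_pow two_ne_zero)
      (((hVint _).add (hNint l)).const_mul c) fun ω => ?_
    have := (hpt l ω).2 (k % h) (Nat.mod_lt k hh).le
    rw [hk] at this
    exact this
  rw [integral_const_mul, integral_add (hVint _) (hNint l)] at h1
  exact h1.trans (by gcongr; exacts [hbd l, hNle l])

end IsRolloutLoop

theorem theorem3 {nx nu ny : ℕ} (S : PlantData nx nu ny) (p h : ℕ) (θ : ℝ)
    (hp : 0 < p) (hh : 0 < h) (hph : p ∣ h) (hθ : 0 < θ)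
    -- standing assumptions on the plant and the cost
    (hR : S.R.PosDef) (hΩw : S.Ωw.PosDef) (hΩv : S.Ωv.PosDef) (hΩ₀ : S.Ω₀.PosSemidef)
    (hAB : IsControllablePair S.A S.B)
    -- the spectral condition
    (hA : EigenvalueCondition S.A p)
    -- full column rank of `C`, positive definite `Q`, stationary initial covariance
    (hC : S.C.rank = nx) (hQ : S.Q.PosDef)
    (hstat : S.Ω₀ = S.Ωw + S.A * S.Ω₀ * S.Aᵀ
      - S.A * S.Ω₀ * S.Cᵀ * (S.C * S.Ω₀ * S.Cᵀ + S.Ωv)⁻¹ * S.C * S.Ω₀ * S.Aᵀ) :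
    (∃ Pt, S.IsPeriodicRiccatiSolution p Pt) ∧
    ∀ Pt, S.IsPeriodicRiccatiSolution p Pt →
      ∀ {Ω : Type*} [MeasurableSpace Ω] (μ : Measure Ω) [IsProbabilityMeasure μ]
        (x₀ : Ω → Vec nx) (w : ℕ → Ω → Vec nx) (v : ℕ → Ω → Vec ny)
        (x : ℕ → Ω → Vec nx) (y : ℕ → Ω → Vec ny) (xhat : ℕ → Ω → Vec nx)
        (u : ℕ → Ω → Vec nu) (δ : ℕ → Ω → Bool) (φ : ℕ → Ω → Fin h → Bool),
        IsPlantNoise μ S x₀ w v →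
        IsRolloutLoop μ S Pt θ h x₀ w v x y xhat u δ φ →
        (⨆ k, ∫⁻ ω, ‖x k ω‖ₑ ^ 2 ∂μ) < ⊤ := by
  refine ⟨S.exists_isPeriodicRiccatiSolution hQ hR hp hAB hA, ?_⟩
  intro Pt hPt Ω _ μ _ x₀ w v x y xhat u δ φ hN hL
  obtain ⟨K₁, hK₁⟩ := hL.exists_integral_error_sq_le hC hh hN
  obtain ⟨K₂, hK₂⟩ := hL.exists_integral_estimate_sq_le hh hp hph hR hQ hC hstat hPt hN
  refine lt_of_le_of_lt (iSup_le fun k => ?_) (ENNReal.ofReal_lt_top (r := 2 * K₁ + 2 * K₂))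
  have hx := hL.memLp_state hN hh k
  have hxhat := hL.memLp_estimate hN hh k
  rw [hx.lintegral_enorm_sq]
  refine ENNReal.ofReal_le_ofReal ?_
  have := integral_norm_add_sq_le (hx.sub hxhat) hxhat
  simp only [Pi.sub_apply, sub_add_cancel] at this
  linarith [hK₁ k, hK₂ k]
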